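/- Let $(M,g,I,J,K)$ be a connected hyperKähler manifold: a connected smooth (Hausdorff, second countable, finite-dimensional, boundaryless) manifold with a smooth Riemannian metric $g$ and three integrable complex structures $I,J,K$ with $IJ=K=-JI$, such that $(g,A)$ is Kähler with Kähler form $\omega_A=g(A\,\cdot,\cdot)$ for each $A=I,J,K$. Suppose that the circle $S^1$ acts smoothly and effectively on $M$, preserving $g$, $I$, $J$ and $K$, and let $X$ be the vector field generating $t\mapsto e^{it}\cdot x$. Suppose the action is tri-Hamiltonian with hyperKähler moment map $\mu=(\mu^I,\mu^J,\mu^K)\colon M\to\mathbb R^3$, that is, $\mu$ is smooth and $d\mu^A=\omega_A(X,\cdot)$ for $A=I,J,K$. Then: 1. $\mu\colon M\to\mathbb R^3$ is an open map. 2. For every fixed point $p$ of the action and every neighbourhood $U$ of $p$ there are $r>0$ and an $S^1$-invariant embedded four-dimensional submanifold $M_1\subseteq U$ containing $p$ such that $\mu$ induces a homeomorphism $$\overline\mu\colon M_1/S^1\longrightarrow B(\mu(p),r)=\{v\in\mathbb R^3:\|v-\mu(p)\|<r\}.$$ Moreover, $M_1$ is a quaternionic slice: it is the image of a smooth embedding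 $\varphi\colon\Omega\to M$ of an open neighbourhood $\Omega$ of $0$ in the quaternions $\mathbb H$ with $\varphi(0)=p$, such that for some non-zero integer $k$ the set $\Omega$ is invariant under $q\mapsto e^{ik\theta}q$ and $\varphi(e^{ik\theta}q)=e^{i\theta}\cdot\varphi(q)$ for all $\theta\in\mathbb R$ and $q\in\Omega$, and such that $d\varphi_0\colon\mathbb H\to T_pM$ intertwines right multiplication by $-i,-j,-k$ on $\mathbb H$ with $I,J,K$ on $T_pM$. -/

import Mathlib

open scoped Manifold ContDiff Quaternion Topology

noncomputable section

namespace Hyperkahler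

section Geometry

variable (E : Type*) [NormedAddCommGroup E] [NormedSpace ℝ E]
  (M : Type*) [TopologicalSpace M] [ChartedSpace E M]

/-- Vector fields on `M` (no regularity imposed). -/
abbrev VField : Type _ := ∀ x : M, TangentSpace 𝓘(ℝ, E) x

/-- Fields of endomorphisms of the tangent spaces of `M` (no regularity imposed). -/
abbrev EndField : Type _ :=
  ∀ x : M, TangentSpace 𝓘(ℝ, E) x →L[ℝ] TangentSpace 𝓘(ℝ, E) x

/-- Smooth Riemannian metrics on `M`. -/
abbrev RMetric [IsManifold 𝓘(ℝ, E) ∞ M] : Type _ :=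
  Bundle.ContMDiffRiemannianMetric 𝓘(ℝ, E) ∞ E (fun x : M => TangentSpace 𝓘(ℝ, E) x)

variable {E M}

/-- `X` is a smooth vector field. -/
def VField.IsSmooth [IsManifold 𝓘(ℝ, E) ∞ M] (X : VField E M) : Prop :=
  ContMDiff 𝓘(ℝ, E) (𝓘(ℝ, E).prod 𝓘(ℝ, E)) ∞
    (fun x => (Bundle.TotalSpace.mk' E x (X x) : TangentBundle 𝓘(ℝ, E) M))

/-- `A` is a smooth section of the endomorphism bundle of the tangent bundle. -/
def EndField.IsSmooth [IsManifold 𝓘(ℝ, E) ∞ M] (A : EndField E M) : Prop :=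
  ContMDiff 𝓘(ℝ, E) (𝓘(ℝ, E).prod 𝓘(ℝ, E →L[ℝ] E)) ∞
    (fun x => Bundle.TotalSpace.mk' (E →L[ℝ] E)
      (E := fun x : M => TangentSpace 𝓘(ℝ, E) x →L[ℝ] TangentSpace 𝓘(ℝ, E) x) x (A x))

/-- The vector field `A X`. -/
def EndField.apply (A : EndField E M) (X : VField E M) : VField E M := fun x => A x (X x)

/-- The Lie bracket `[X, Y]` of vector fields. -/
abbrev VField.bracket (X Y : VField E M) : VField E M :=
  VectorField.mlieBracket 𝓘(ℝ, E) X Y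

/-- The directional derivative `X f` of a function. -/
def VField.deriv (X : VField E M) (f : M → ℝ) (x : M) : ℝ :=
  mfderiv 𝓘(ℝ, E) 𝓘(ℝ, ℝ) f x (X x)

/-- `A` is an (integrable) complex structure: a smooth almost complex structure whose
Nijenhuis tensor vanishes. -/
structure IsComplexStructure [IsManifold 𝓘(ℝ, E) ∞ M] (A : EndField E M) : Prop where
  smooth : A.IsSmooth
  sq : ∀ (x : M) (v : TangentSpace 𝓘(ℝ, E) x), A x (A x v) = -v
  nijenhuis : ∀ X Y : VField E M, X.IsSmooth → Y.IsSmooth → ∀ x : M,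
    (A.apply X).bracket (A.apply Y) x - A x ((A.apply X).bracket Y x)
      - A x (X.bracket (A.apply Y) x) - X.bracket Y x = 0

/-- A two-form is closed: `dσ = 0`, with `dσ` written out through its invariant formula
`dσ(X,Y,Z) = X σ(Y,Z) + Y σ(Z,X) + Z σ(X,Y) - σ([X,Y],Z) - σ([Y,Z],X) - σ([Z,X],Y)`. -/
def IsClosedForm [IsManifold 𝓘(ℝ, E) ∞ M]
    (σ : ∀ x : M, TangentSpace 𝓘(ℝ, E) x → TangentSpace 𝓘(ℝ, E) x → ℝ) : Prop :=
  ∀ X Y Z : VField E M, X.IsSmooth → Y.IsSmooth → Z.IsSmooth → ∀ x : M,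
    X.deriv (fun y => σ y (Y y) (Z y)) x + Y.deriv (fun y => σ y (Z y) (X y)) x
      + Z.deriv (fun y => σ y (X y) (Y y)) x
      - σ x (X.bracket Y x) (Z x) - σ x (Y.bracket Z x) (X x) - σ x (Z.bracket X x) (Y x) = 0

/-- The two-form `ω_A = g(A ·, ·)`. -/
def fundamentalForm [IsManifold 𝓘(ℝ, E) ∞ M] (g : RMetric E M) (A : EndField E M) (x : M)
    (u v : TangentSpace 𝓘(ℝ, E) x) : ℝ :=
  g.inner x (A x u) v

/-- `(g, A)` is a Kähler structure: `A` is a complex structure, `g` is Hermitian for `A`, and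
`ω_A = g(A ·, ·)` is closed. -/
structure IsKahler [IsManifold 𝓘(ℝ, E) ∞ M] (g : RMetric E M) (A : EndField E M) : Prop where
  complex : IsComplexStructure A
  hermitian : ∀ (x : M) (u v : TangentSpace 𝓘(ℝ, E) x),
    g.inner x (A x u) (A x v) = g.inner x u v
  closed : IsClosedForm (fundamentalForm g A)

variable (E M) in
/-- A hyperKähler structure on `M`: a Riemannian metric `g` that is Kähler for each of three
complex structures `I`, `J`, `K` with `IJ = K = -JI`. -/
structure HyperkahlerStructure [IsManifold 𝓘(ℝ, E) ∞ M] where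
  g : RMetric E M
  I : EndField E M
  J : EndField E M
  K : EndField E M
  kahler_I : IsKahler g I
  kahler_J : IsKahler g J
  kahler_K : IsKahler g K
  mul_IJ : ∀ (x : M) (v : TangentSpace 𝓘(ℝ, E) x), I x (J x v) = K x v
  mul_JI : ∀ (x : M) (v : TangentSpace 𝓘(ℝ, E) x), J x (I x v) = -K x v

/-- `X` is the vector field generating the circle action: for each `x`, the curve
`t ↦ exp(it) • x` is an integral curve of `X`. -/
def Generates [SMul Circle M] (X : VField E M) : Prop :=
  ∀ x : M, IsMIntegralCurve (I := 𝓘(ℝ, E)) (fun t : ℝ => Circle.exp t • x) X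

/-- The differential at `x` of the diffeomorphism `y ↦ z • y`. -/
def actionDeriv [SMul Circle M] (z : Circle) (x : M) :
    TangentSpace 𝓘(ℝ, E) x →L[ℝ] TangentSpace 𝓘(ℝ, E) (z • x) :=
  mfderiv 𝓘(ℝ, E) 𝓘(ℝ, E) (fun y : M => z • y) x

/-- The action preserves the field of endomorphisms `A`. -/
def Preserves [SMul Circle M] (A : EndField E M) : Prop :=
  ∀ (z : Circle) (x : M) (v : TangentSpace 𝓘(ℝ, E) x),
    actionDeriv z x (A x v) = A (z • x) (actionDeriv z x v)

/-- The (smooth) circle action generated by `X` is tri-Hamiltonian with hyperKähler moment map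
`μ = (μ^I, μ^J, μ^K)`: it preserves `g`, `I`, `J`, `K`, and `μ` is a smooth map with
`dμ^A = X ⌟ ω_A` for `A = I, J, K`. -/
structure IsTriHamiltonian [IsManifold 𝓘(ℝ, E) ∞ M] [SMul Circle M]
    (h : HyperkahlerStructure E M) (X : VField E M) (μ : M → EuclideanSpace ℝ (Fin 3)) :
    Prop where
  generates : Generates X
  isometric : ∀ (z : Circle) (x : M) (u v : TangentSpace 𝓘(ℝ, E) x),
    h.g.inner (z • x) (actionDeriv z x u) (actionDeriv z x v) = h.g.inner x u v
  preserves_I : Preserves h.I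
  preserves_J : Preserves h.J
  preserves_K : Preserves h.K
  smooth : ContMDiff 𝓘(ℝ, E) 𝓘(ℝ, EuclideanSpace ℝ (Fin 3)) ∞ μ
  moment_I : ∀ (x : M) (v : TangentSpace 𝓘(ℝ, E) x),
    mfderiv 𝓘(ℝ, E) 𝓘(ℝ, ℝ) (fun y => μ y 0) x v = fundamentalForm h.g h.I x (X x) v
  moment_J : ∀ (x : M) (v : TangentSpace 𝓘(ℝ, E) x),
    mfderiv 𝓘(ℝ, E) 𝓘(ℝ, ℝ) (fun y => μ y 1) x v = fundamentalForm h.g h.J x (X x) v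
  moment_K : ∀ (x : M) (v : TangentSpace 𝓘(ℝ, E) x),
    mfderiv 𝓘(ℝ, E) 𝓘(ℝ, ℝ) (fun y => μ y 2) x v = fundamentalForm h.g h.K x (X x) v

end Geometry

/-- The quaternion unit `i`. -/
def qi : ℍ := ⟨0, 1, 0, 0⟩

/-- The quaternion unit `j`. -/
def qj : ℍ := ⟨0, 0, 1, 0⟩

/-- The quaternion unit `k`. -/
def qk : ℍ := ⟨0, 0, 0, 1⟩

/-- The weight `k` action of the circle on the quaternions: `exp(iθ)` acts by
`q ↦ exp(ikθ) q`. -/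
def rotate (k : ℤ) (z : Circle) (q : ℍ) : ℍ := (((z ^ k : Circle) : ℂ) : ℍ) * q

section Slice

variable {E : Type*} [NormedAddCommGroup E] [NormedSpace ℝ E]
  {M : Type*} [TopologicalSpace M] [ChartedSpace E M] [IsManifold 𝓘(ℝ, E) ∞ M]

/-- `S` is a four-dimensional quaternionic slice at `p`: it is an `S¹`-invariant embedded
submanifold containing `p` which is the image of a smooth embedding `φ` of an open
neighbourhood `Ω` of `0` in `ℍ` with `φ 0 = p`, where `φ` is equivariant for the circle action
`q ↦ exp(ikθ) q` on `ℍ` with `k ≠ 0`, and the differential of `φ` at `0` is quaternionic.  On `ℍ`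
the complex structures are the right multiplications by `-i`, `-j`, `-k`; they commute
with the circle action and satisfy `IJ = K = -JI`. -/
def IsSlice [MulAction Circle M] (h : HyperkahlerStructure E M) (p : M)
    (S : SubMulAction Circle M) : Prop :=
  ∃ (k : ℤ) (Ω : Set ℍ) (φ : ℍ → M),
    k ≠ 0 ∧ IsOpen Ω ∧ (0 : ℍ) ∈ Ω ∧ (∀ z : Circle, ∀ q ∈ Ω, rotate k z q ∈ Ω) ∧
    ContMDiffOn 𝓘(ℝ, ℍ) 𝓘(ℝ, E) ∞ φ Ω ∧
    (∀ q ∈ Ω, Function.Injective (mfderiv 𝓘(ℝ, ℍ) 𝓘(ℝ, E) φ q)) ∧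
    Topology.IsEmbedding (Ω.domRestrict φ) ∧
    φ '' Ω = (S : Set M) ∧ φ 0 = p ∧
    (∀ z : Circle, ∀ q ∈ Ω, φ (rotate k z q) = z • φ q) ∧
    (∀ v : ℍ,
      mfderiv 𝓘(ℝ, ℍ) 𝓘(ℝ, E) φ 0 (v * -qi : ℍ) =
        h.I (φ 0) (mfderiv 𝓘(ℝ, ℍ) 𝓘(ℝ, E) φ 0 v) ∧
      mfderiv 𝓘(ℝ, ℍ) 𝓘(ℝ, E) φ 0 (v * -qj : ℍ) =
        h.J (φ 0) (mfderiv 𝓘(ℝ, ℍ) 𝓘(ℝ, E) φ 0 v) ∧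
      mfderiv 𝓘(ℝ, ℍ) 𝓘(ℝ, E) φ 0 (v * -qk : ℍ) =
        h.K (φ 0) (mfderiv 𝓘(ℝ, ℍ) 𝓘(ℝ, E) φ 0 v))

end Slice

/-- The map induced by `μ` on the orbit space of the invariant set `S` is a homeomorphism
from `S / S¹` (with the quotient topology) onto the set `B`. -/
def InducesHomeomorph {M N : Type*} [TopologicalSpace M] [TopologicalSpace N]
    [MulAction Circle M] (S : SubMulAction Circle M) (μ : M → N) (B : Set N) : Prop :=
  ∃ Φ : MulAction.orbitRel.Quotient Circle S ≃ₜ B,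
    ∀ x : S, (Φ (Quotient.mk (MulAction.orbitRel Circle S) x) : N) = μ x

end Hyperkahler

end

/-! Away from fixed points the generator X is non-zero, and IX, JX, KX are mutually orthogonal of
equal length, so dμ is onto and μ is open there (`nhds_le_map_of_ne_zero`). The substance lies at a
fixed point p.

Averaging a chart over the circle makes the action linear near p (`exists_linearization`).
Effectiveness and connectedness make the isotropy representation non-trivial (`exists_ne_id`). Its
generator D is skew and commutes with I, so ID is symmetric and has an eigenvector w with non-zero
eigenvalue; periodicity makes this eigenvalue an integer k (`exists_weight_vector`). The
quaternionic span of w is an invariant copy of ℍ of weight k, and the slice is a piece of it in the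
linearizing coordinates.

On this copy of ℍ, X vanishes linearly at the origin and the Kähler forms are continuous. Hence the
derivative of μ differs by o(|q|) from that of c q̄ i q, with c = k g(w,w)/2 (`isHopfLike`). The
Hopf map q ↦ q̄ i q identifies ℍ/S¹ with ℝ³, so the invariant function μ descends to a map F near 0
in ℝ³. If q and q' are rotated to be aligned, then |q̄ i q - q̄' i q'| = |q + q'| |q - q'|
(`exists_aligned_rotate`), which dominates the error ε max(|q|,|q'|) |q - q'|. So F is a small
Lipschitz perturbation of a homothety, hence a homeomorphism near 0 (`local_structure`); no
differentiability of F is needed. Openness of μ at fixed points is then read off from the slices. -/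

noncomputable section

namespace Hyperkahler

/-! ### The Hopf map and the identification of ℍ/S¹ with ℝ³ -/

/-- The quadratic map `q ↦ q̄ i q` from the quaternions to the imaginary quaternions. -/
def hopf (q : ℍ) : EuclideanSpace ℝ (Fin 3) :=
  !₂[q.re ^ 2 + q.imI ^ 2 - q.imJ ^ 2 - q.imK ^ 2,
    2 * (q.imI * q.imJ - q.re * q.imK), 2 * (q.re * q.imJ + q.imI * q.imK)]

@[simp] lemma hopf_zero_coord (q : ℍ) :
    hopf q 0 = q.re ^ 2 + q.imI ^ 2 - q.imJ ^ 2 - q.imK ^ 2 := rfl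

@[simp] lemma hopf_one_coord (q : ℍ) : hopf q 1 = 2 * (q.imI * q.imJ - q.re * q.imK) := rfl

@[simp] lemma hopf_two_coord (q : ℍ) : hopf q 2 = 2 * (q.re * q.imJ + q.imI * q.imK) := rfl

lemma quaternion_norm_sq (q : ℍ) :
    ‖q‖ ^ 2 = q.re ^ 2 + q.imI ^ 2 + q.imJ ^ 2 + q.imK ^ 2 := by
  rw [sq, ← Quaternion.normSq_eq_norm_mul_self, Quaternion.normSq_def']

lemma euclidean_norm_sq (v : EuclideanSpace ℝ (Fin 3)) :
    ‖v‖ ^ 2 = v 0 ^ 2 + v 1 ^ 2 + v 2 ^ 2 := by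
  rw [EuclideanSpace.real_norm_sq_eq, Fin.sum_univ_three]

lemma norm_hopf (q : ℍ) : ‖hopf q‖ = ‖q‖ ^ 2 := by
  rw [← sq_eq_sq₀ (norm_nonneg _) (by positivity), euclidean_norm_sq, quaternion_norm_sq]
  simp only [hopf_zero_coord, hopf_one_coord, hopf_two_coord]
  ring

lemma rotate_one_re (z : Circle) (q : ℍ) :
    (rotate 1 z q).re = (z : ℂ).re * q.re - (z : ℂ).im * q.imI := by
  simp [rotate]

lemma rotate_one_imI (z : Circle) (q : ℍ) :
    (rotate 1 z q).imI = (z : ℂ).re * q.imI + (z : ℂ).im * q.re := by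
  simp [rotate]

lemma rotate_one_imJ (z : Circle) (q : ℍ) :
    (rotate 1 z q).imJ = (z : ℂ).re * q.imJ - (z : ℂ).im * q.imK := by
  simp [rotate]

lemma rotate_one_imK (z : Circle) (q : ℍ) :
    (rotate 1 z q).imK = (z : ℂ).re * q.imK + (z : ℂ).im * q.imJ := by
  simp [rotate]

lemma circle_sq_add_sq (z : Circle) : (z : ℂ).re ^ 2 + (z : ℂ).im ^ 2 = 1 := by
  have := z.normSq_coe
  rw [Complex.normSq_apply] at this
  linarith

lemma rotate_eq_rotate_one (k : ℤ) (z : Circle) (q : ℍ) : rotate k z q = rotate 1 (z ^ k) q := by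
  simp [rotate]

lemma norm_rotate (k : ℤ) (z : Circle) (q : ℍ) : ‖rotate k z q‖ = ‖q‖ := by
  rw [rotate_eq_rotate_one, ← sq_eq_sq₀ (norm_nonneg _) (norm_nonneg _), quaternion_norm_sq,
    quaternion_norm_sq, rotate_one_re, rotate_one_imI, rotate_one_imJ, rotate_one_imK]
  linear_combination (q.re ^ 2 + q.imI ^ 2 + q.imJ ^ 2 + q.imK ^ 2) * circle_sq_add_sq (z ^ k)

/-- Used to see that the weight k action, k ≠ 0, has the same orbits as the weight one action, so
that the Hopf map serves as the model for every weight. -/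
lemma exists_zpow_eq {k : ℤ} (hk : k ≠ 0) (z : Circle) : ∃ y : Circle, y ^ k = z := by
  obtain ⟨t, rfl⟩ := Circle.exp_surjective z
  refine ⟨Circle.exp (t / k), ?_⟩
  rw [← Circle.exp_zsmul]
  congr 1
  have : (k : ℝ) ≠ 0 := by exact_mod_cast hk
  simp
  field_simp

/-- A unit complex number z commutes with i, so z̄ i z = i in the middle of q̄ z̄ i z q. -/
lemma hopf_rotate_one (z : Circle) (q : ℍ) : hopf (rotate 1 z q) = hopf q := by
  have hz := circle_sq_add_sq z
  have hz' : (z : ℂ).re ^ 2 = 1 - (z : ℂ).im ^ 2 := by linarith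
  ext i
  fin_cases i
  · simp only [Fin.zero_eta, hopf_zero_coord, rotate_one_re, rotate_one_imI, rotate_one_imJ,
      rotate_one_imK]
    linear_combination (q.re ^ 2 + q.imI ^ 2 - q.imJ ^ 2 - q.imK ^ 2) * hz
  · simp only [Fin.mk_one, hopf_one_coord, rotate_one_re, rotate_one_imI, rotate_one_imJ,
      rotate_one_imK]
    linear_combination (2 * (q.imI * q.imJ - q.re * q.imK)) * hz
  · simp only [Fin.reduceFinMk, hopf_two_coord, rotate_one_re, rotate_one_imI, rotate_one_imJ,
      rotate_one_imK]
    linear_combination (2 * (q.re * q.imJ + q.imI * q.imK)) * hz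

/-- Any quaternion `q'` can be rotated into a position `s` that is best aligned with `q`;
then `hopf q - hopf q' = Im ((q + s)̄ i (q - s))`. -/
lemma exists_aligned_rotate (q q' : ℍ) : ∃ z : Circle,
    ‖hopf q - hopf q'‖ = ‖q + rotate 1 z q'‖ * ‖q - rotate 1 z q'‖ ∧
    ‖q - rotate 1 z q'‖ ≤ ‖q + rotate 1 z q'‖ ∧ ‖q‖ ≤ ‖q + rotate 1 z q'‖ ∧
    ‖q'‖ ≤ ‖q + rotate 1 z q'‖ := by
  -- These are ⟨q, q'⟩ and ⟨q, iq'⟩. Taking z to be the phase of α + iβ makes ⟨q, zq'⟩ = |α + iβ| ≥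
  -- 0 and ⟨iq, zq'⟩ = 0.
  set α : ℝ := q.re * q'.re + q.imI * q'.imI + q.imJ * q'.imJ + q.imK * q'.imK with hα
  set β : ℝ := -q.re * q'.imI + q.imI * q'.re - q.imJ * q'.imK + q.imK * q'.imJ with hβ
  obtain ⟨z, hz⟩ : ∃ z : Circle, (⟨α, β⟩ : ℂ) = (‖(⟨α, β⟩ : ℂ)‖ : ℂ) * z := by
    refine ⟨Circle.exp (Complex.arg ⟨α, β⟩), ?_⟩
    rw [Circle.coe_exp, Complex.norm_mul_exp_arg_mul_I]
  set n : ℝ := ‖(⟨α, β⟩ : ℂ)‖ with hn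
  have hn0 : 0 ≤ n := norm_nonneg _
  have h1 : α = n * (z : ℂ).re := by simpa using congrArg Complex.re hz
  have h2 : β = n * (z : ℂ).im := by simpa using congrArg Complex.im hz
  have hzz := circle_sq_add_sq z
  set a := (z : ℂ).re
  set b := (z : ℂ).im
  set s := rotate 1 z q' with hs
  have s0 : s.re = a * q'.re - b * q'.imI := rotate_one_re z q'
  have s1 : s.imI = a * q'.imI + b * q'.re := rotate_one_imI z q'
  have s2 : s.imJ = a * q'.imJ - b * q'.imK := rotate_one_imJ z q'
  have s3 : s.imK = a * q'.imK + b * q'.imJ := rotate_one_imK z q'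
  have hin : q.re * s.re + q.imI * s.imI + q.imJ * s.imJ + q.imK * s.imK = n := by
    rw [s0, s1, s2, s3]
    linear_combination a * h1 + b * h2 + n * hzz + a * hα - a * h1 + b * hβ - b * h2 + 
      a * (h1 - hα) + b * (h2 - hβ)
  have hort : -q.imI * s.re + q.re * s.imI - q.imK * s.imJ + q.imJ * s.imK = 0 := by
    rw [s0, s1, s2, s3]
    linear_combination b * (h1 - hα) - a * (h2 - hβ)
  have hsn : ‖s‖ = ‖q'‖ := norm_rotate 1 z q'
  have hqs : hopf q' = hopf s := (hopf_rotate_one z q').symm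
  have hpos : 0 ≤ ‖q + s‖ := norm_nonneg _
  have e1 : ‖q + s‖ ^ 2 = ‖q‖ ^ 2 + ‖s‖ ^ 2 + 2 * n := by
    rw [quaternion_norm_sq, quaternion_norm_sq, quaternion_norm_sq]
    simp only [Quaternion.re_add, Quaternion.imI_add, Quaternion.imJ_add, Quaternion.imK_add]
    linear_combination 2 * hin
  have e2 : ‖q - s‖ ^ 2 = ‖q‖ ^ 2 + ‖s‖ ^ 2 - 2 * n := by
    rw [quaternion_norm_sq, quaternion_norm_sq, quaternion_norm_sq]
    simp only [Quaternion.re_sub, Quaternion.imI_sub, Quaternion.imJ_sub, Quaternion.imK_sub]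
    linear_combination -2 * hin
  refine ⟨z, ?_, ?_, ?_, ?_⟩
  -- The product (q + s)̄ i (q - s) is `hopf q - hopf s` plus a real number proportional to ⟨iq, s⟩,
  -- which vanishes by `hort`; quaternionic norms multiply.
  · rw [hqs, ← sq_eq_sq₀ (norm_nonneg _) (by positivity), mul_pow, euclidean_norm_sq,
      quaternion_norm_sq, quaternion_norm_sq]
    simp only [Quaternion.re_add, Quaternion.imI_add, Quaternion.imJ_add, Quaternion.imK_add,
      Quaternion.re_sub, Quaternion.imI_sub, Quaternion.imJ_sub, Quaternion.imK_sub,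
      PiLp.sub_apply, hopf_zero_coord, hopf_one_coord, hopf_two_coord]
    linear_combination (-4) * (-q.imI * s.re + q.re * s.imI - q.imK * s.imJ + q.imJ * s.imK) * hort
  · refine abs_le_of_sq_le_sq' ?_ hpos |>.2
    rw [e1, e2]; linarith
  · refine abs_le_of_sq_le_sq' ?_ hpos |>.2
    rw [e1]; nlinarith [sq_nonneg ‖s‖]
  · refine abs_le_of_sq_le_sq' ?_ hpos |>.2
    rw [e1, ← hsn]; nlinarith [sq_nonneg ‖q‖]

/-- After alignment the product |q + s| |q - s| vanishes, and the second factor is the smaller one.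
-/
lemma exists_rotate_of_hopf_eq {q q' : ℍ} (h : hopf q = hopf q') :
    ∃ z : Circle, q = rotate 1 z q' := by
  obtain ⟨z, h1, h2, -⟩ := exists_aligned_rotate q q'
  refine ⟨z, ?_⟩
  rw [h, sub_self, norm_zero] at h1
  rw [← sub_eq_zero, ← norm_eq_zero]
  rcases mul_eq_zero.1 h1.symm with h3 | h3
  · exact le_antisymm (h3 ▸ h2) (norm_nonneg _)
  · exact h3

lemma hopf_eq_of_coord {q : ℍ} {y : EuclideanSpace ℝ (Fin 3)}
    (h0 : q.re ^ 2 + q.imI ^ 2 - q.imJ ^ 2 - q.imK ^ 2 = y 0)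
    (h1 : 2 * (q.imI * q.imJ - q.re * q.imK) = y 1)
    (h2 : 2 * (q.re * q.imJ + q.imI * q.imK) = y 2) : hopf q = y := by
  ext i
  fin_cases i
  exacts [h0, h1, h2]

lemma hopf_surjective : Function.Surjective hopf := by
  intro y
  have hy := euclidean_norm_sq y
  have hn := norm_nonneg y
  set n := ‖y‖
  -- The explicit section with real first entry degenerates exactly on the ray y 0 = -‖y‖, where a
  -- multiple of j is a preimage.
  by_cases h : n + y 0 = 0
  · have h12 : y 1 ^ 2 + y 2 ^ 2 = 0 := by
      have : y 0 = - n := by linarith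
      rw [this] at hy; linarith
    have h1 : y 1 = 0 := by nlinarith [sq_nonneg (y 1), sq_nonneg (y 2)]
    have h2 : y 2 = 0 := by nlinarith [sq_nonneg (y 1), sq_nonneg (y 2)]
    refine ⟨⟨0, 0, Real.sqrt n, 0⟩, hopf_eq_of_coord ?_ ?_ ?_⟩
    · simp [Real.sq_sqrt hn]; linarith
    · simp [h1]
    · simp [h2]
  · have hpos : 0 < n + y 0 := by
      refine lt_of_le_of_ne ?_ (Ne.symm h)
      have : |y 0| ≤ n := by
        rw [← abs_of_nonneg hn]
        exact sq_le_sq.1 (by nlinarith [sq_nonneg (y 1), sq_nonneg (y 2)])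
      linarith [neg_abs_le (y 0)]
    set a := Real.sqrt ((n + y 0) / 2)
    have ha : a ^ 2 = (n + y 0) / 2 := Real.sq_sqrt (by positivity)
    have ha0 : a ≠ 0 := (Real.sqrt_pos.2 (by positivity)).ne'
    refine ⟨⟨a, 0, y 2 / (2 * a), -y 1 / (2 * a)⟩, hopf_eq_of_coord ?_ ?_ ?_⟩
    · have : (y 1 ^ 2 + y 2 ^ 2) = (n - y 0) * (2 * a ^ 2) := by rw [ha]; linarith
      have h4 : (y 2 / (2 * a)) ^ 2 + (-y 1 / (2 * a)) ^ 2 = (n - y 0) / 2 := by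
        field_simp
        linarith
      simp only
      linarith
    · simp; field_simp
    · simp; field_simp

lemma continuous_hopf : Continuous hopf := by
  refine (PiLp.continuous_toLp 2 _).comp (continuous_pi fun i => ?_)
  have h0 := Quaternion.continuous_re
  have h1 := Quaternion.continuous_imI
  have h2 := Quaternion.continuous_imJ
  have h3 := Quaternion.continuous_imK
  fin_cases i <;> simp <;> fun_prop

/-- For an aligned representative s, |q - s|² ≤ |q + s| |q - s| = |hopf q - hopf s|, so a ball of
radius ε² around the image is covered by the ball of radius ε around q. -/
lemma isOpenMap_hopf : IsOpenMap hopf := by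
  rw [isOpenMap_iff_nhds_le]
  intro q
  rw [Filter.le_map_iff]
  intro s hs
  obtain ⟨ε, hε, hball⟩ := Metric.mem_nhds_iff.1 hs
  refine Filter.mem_of_superset (Metric.ball_mem_nhds _ (show 0 < ε ^ 2 by positivity)) ?_
  intro y hy
  obtain ⟨q', rfl⟩ := hopf_surjective y
  obtain ⟨z, h1, h2, -⟩ := exists_aligned_rotate q q'
  refine ⟨rotate 1 z q', hball ?_, hopf_rotate_one z q'⟩
  rw [Metric.mem_ball, dist_comm, dist_eq_norm] at hy ⊢
  refine abs_lt_of_sq_lt_sq ?_ hε.le |>.trans_le' (le_abs_self _)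
  nlinarith [norm_nonneg (q - rotate 1 z q')]

/-! ### Perturbations of the Hopf map -/

/-- The derivative of `q ↦ hopf q i` at `q` in the direction `v` is `2 * hopfPolar q v i`. -/
def hopfPolar (q v : ℍ) : EuclideanSpace ℝ (Fin 3) :=
  !₂[q.re * v.re + q.imI * v.imI - q.imJ * v.imJ - q.imK * v.imK,
    q.imI * v.imJ + v.imI * q.imJ - q.re * v.imK - v.re * q.imK,
    q.re * v.imJ + v.re * q.imJ + q.imI * v.imK + v.imI * q.imK]

lemma hopf_line (q v : ℍ) (t : ℝ) :
    hopf (q + t • v) = hopf q + (2 * t) • hopfPolar q v + t ^ 2 • hopf v := by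
  refine hopf_eq_of_coord ?_ ?_ ?_ <;>
    simp [hopfPolar] <;> ring

/-- A map that agrees with `c • hopf` to second order at `0`. -/
structure IsHopfLike (f : ℍ → EuclideanSpace ℝ (Fin 3)) (c : ℝ) : Prop where
  differentiable : ∀ᶠ q in 𝓝 (0 : ℍ), ∀ i, DifferentiableAt ℝ (fun x => f x i) q
  close : ∀ ε > 0, ∀ᶠ q in 𝓝 (0 : ℍ), ∀ i v,
    |fderiv ℝ (fun x => f x i) q v - 2 * c * hopfPolar q v i| ≤ ε * ‖q‖ * ‖v‖

lemma hopfPolar_add_smul (q v : ℍ) (t : ℝ) :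
    hopfPolar (q + t • v) v = hopfPolar q v + t • hopf v := by
  ext i
  fin_cases i <;> simp [hopfPolar, hopf] <;> ring

lemma hasDerivAt_quadratic (c a b d t : ℝ) :
    HasDerivAt (fun t => c * (a + 2 * t * b + t ^ 2 * d)) (2 * c * (b + t * d)) t := by
  have h1 : HasDerivAt (fun t : ℝ => 2 * t * b) (2 * 1 * b) t :=
    ((hasDerivAt_id t).const_mul 2).mul_const b
  have h2 : HasDerivAt (fun t : ℝ => t ^ 2 * d) (2 * t ^ 1 * 1 * d) t := by
    simpa using ((hasDerivAt_id t).pow 2).mul_const d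
  have h3 : HasDerivAt (fun t => c * (a + 2 * t * b + t ^ 2 * d))
      (c * (2 * 1 * b + 2 * t ^ 1 * 1 * d)) t := ((h1.const_add a).add h2).const_mul c
  exact h3.congr_deriv (by ring)

/-- Mean value inequality for f - c • hopf on the segment from q' to q, whose points have norm at
most max(|q|,|q'|). -/
lemma IsHopfLike.lipschitz {f : ℍ → EuclideanSpace ℝ (Fin 3)} {c : ℝ} (hf : IsHopfLike f c)
    {ε : ℝ} (hε : 0 < ε) : ∃ δ > 0, ∀ q ∈ Metric.ball (0 : ℍ) δ, ∀ q' ∈ Metric.ball (0 : ℍ) δ,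
      ‖f q - f q' - c • (hopf q - hopf q')‖ ≤ ε * max ‖q‖ ‖q'‖ * ‖q - q'‖ := by
  -- Half of ε in each coordinate suffices: three coordinates cost a factor √3 < 2.
  obtain ⟨δ, hδ, h⟩ := Metric.eventually_nhds_iff_ball.1
    (hf.differentiable.and (hf.close (ε / 2) (half_pos hε)))
  refine ⟨δ, hδ, fun q hq q' hq' => ?_⟩
  set m := max ‖q‖ ‖q'‖ with hm
  have hm0 : 0 ≤ m := (norm_nonneg q).trans (le_max_left _ _)
  set v := q - q' with hv
  have key : ∀ i, |(f q - f q' - c • (hopf q - hopf q')) i| ≤ ε / 2 * m * ‖v‖ := by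
    intro i
    set g : ℝ → ℝ := fun t => f (q' + t • v) i - c * hopf (q' + t • v) i with hg
    have hseg : ∀ t ∈ Set.Icc (0 : ℝ) 1, q' + t • v ∈ Metric.ball (0 : ℍ) δ ∧
        ‖q' + t • v‖ ≤ m := by
      intro t ht
      have e : q' + t • v = (1 - t) • q' + t • q := by
        rw [hv, smul_sub, sub_smul, one_smul]; abel
      refine ⟨e ▸ (convex_ball (0 : ℍ) δ) hq' hq (by linarith [ht.2]) ht.1 (by ring), ?_⟩
      rw [e]
      refine (norm_add_le _ _).trans ?_
      rw [norm_smul, norm_smul, Real.norm_of_nonneg ht.1,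
        Real.norm_of_nonneg (by linarith [ht.2] : 0 ≤ 1 - t)]
      have := le_max_left ‖q‖ ‖q'‖
      have := le_max_right ‖q‖ ‖q'‖
      nlinarith [ht.1, ht.2]
    have hder : ∀ t ∈ Set.Icc (0 : ℝ) 1, HasDerivWithinAt g
        (fderiv ℝ (fun x => f x i) (q' + t • v) v - 2 * c * hopfPolar (q' + t • v) v i)
        (Set.Icc 0 1) t := by
      intro t ht
      have h1 : HasDerivAt (fun t : ℝ => q' + t • v) v t := by
        simpa using ((hasDerivAt_id t).smul_const v).const_add q'
      have h2 := ((h _ (hseg t ht).1).1 i).hasFDerivAt.comp_hasDerivAt t h1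
      have h3 : HasDerivAt (fun t : ℝ => c * hopf (q' + t • v) i)
          (2 * c * hopfPolar (q' + t • v) v i) t := by
        have h4 : (fun t : ℝ => c * hopf (q' + t • v) i) = fun t =>
            c * (hopf q' i + 2 * t * hopfPolar q' v i + t ^ 2 * hopf v i) := by
          funext t
          rw [hopf_line]
          simp
        rw [h4, hopfPolar_add_smul]
        refine (hasDerivAt_quadratic c _ _ _ t).congr_deriv ?_
        simp
      exact (h2.sub h3).hasDerivWithinAt
    have hb := norm_image_sub_le_of_norm_deriv_le_segment_01' hder (C := ε / 2 * m * ‖v‖) (by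
      intro t ht
      have ht' : t ∈ Set.Icc (0 : ℝ) 1 := ⟨ht.1, ht.2.le⟩
      refine ((h _ (hseg t ht').1).2 i v).trans ?_
      gcongr
      exact (hseg t ht').2)
    have e1 : q' + (1 : ℝ) • v = q := by simp [hv]
    have e0 : q' + (0 : ℝ) • v = q' := by simp
    simp only [hg, e1, e0, Real.norm_eq_abs] at hb
    convert hb using 2
    simp
    ring
  refine abs_le_of_sq_le_sq' ?_ (by positivity) |>.2
  rw [euclidean_norm_sq]
  have h0 := sq_le_sq' (abs_le.1 (key 0)).1 (abs_le.1 (key 0)).2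
  have h1 := sq_le_sq' (abs_le.1 (key 1)).1 (abs_le.1 (key 1)).2
  have h2 := sq_le_sq' (abs_le.1 (key 2)).1 (abs_le.1 (key 2)).2
  nlinarith [sq_nonneg (ε / 2 * m * ‖v‖)]

/-- A rotation invariant map which agrees with a nonzero multiple of `hopf` to second order
descends, near the origin, to a local homeomorphism of `ℍ / S¹ ≅ ℝ³`. -/
lemma IsHopfLike.local_structure {f : ℍ → EuclideanSpace ℝ (Fin 3)} {c : ℝ} (hf : IsHopfLike f c)
    (hc : c ≠ 0) {ρ : ℝ} (hρ : 0 < ρ)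
    (hinv : ∀ q ∈ Metric.ball (0 : ℍ) ρ, ∀ z : Circle, f (rotate 1 z q) = f q) :
    ∃ δ > 0, δ ≤ ρ ∧ ContinuousOn f (Metric.ball 0 δ) ∧
      (∀ q ∈ Metric.ball (0 : ℍ) δ, ∀ q' ∈ Metric.ball (0 : ℍ) δ, f q = f q' →
        ∃ z : Circle, q = rotate 1 z q') ∧
      (∀ V ⊆ Metric.ball (0 : ℍ) δ, IsOpen V → IsOpen (f '' V)) := by
  obtain ⟨δ₁, hδ₁, hlip⟩ := hf.lipschitz (half_pos (abs_pos.2 hc))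
  set δ := min δ₁ ρ with hδ
  have hδ0 : 0 < δ := lt_min hδ₁ hρ
  -- The section σ need not be continuous: invariance of f makes F independent of the choice on the
  -- relevant ball.
  choose σ hσ using hopf_surjective
  set F : EuclideanSpace ℝ (Fin 3) → EuclideanSpace ℝ (Fin 3) := fun y => c⁻¹ • f (σ y) with hF
  have hmem : ∀ q, q ∈ Metric.ball (0 : ℍ) δ ↔ hopf q ∈ Metric.ball 0 (δ ^ 2) := by
    intro q
    rw [mem_ball_zero_iff, mem_ball_zero_iff, norm_hopf]
    exact (sq_lt_sq₀ (norm_nonneg _) hδ0.le).symm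
  have hrot : ∀ q, ∀ z : Circle, rotate 1 z q ∈ Metric.ball (0 : ℍ) δ ↔
      q ∈ Metric.ball (0 : ℍ) δ := by
    intro q z
    rw [mem_ball_zero_iff, mem_ball_zero_iff, norm_rotate]
  have hb₁ : Metric.ball (0 : ℍ) δ ⊆ Metric.ball 0 δ₁ := Metric.ball_subset_ball (min_le_left _ _)
  have hb₂ : Metric.ball (0 : ℍ) δ ⊆ Metric.ball 0 ρ := Metric.ball_subset_ball (min_le_right _ _)
  have hfF : ∀ q ∈ Metric.ball (0 : ℍ) δ, f q = c • F (hopf q) := by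
    intro q hq
    obtain ⟨z, hz⟩ := exists_rotate_of_hopf_eq (hσ (hopf q))
    rw [hF]
    simp only
    rw [smul_inv_smul₀ hc, hz, hinv q (hb₂ hq)]
  -- F is within Lipschitz distance 1/2 of the identity; this explains the accuracy |c|/2 requested
  -- above. It is enough for the inverse function theorem in its Lipschitz form.
  have happ : ApproximatesLinearOn F
      ((ContinuousLinearEquiv.refl ℝ (EuclideanSpace ℝ (Fin 3)) :
        EuclideanSpace ℝ (Fin 3) ≃L[ℝ] EuclideanSpace ℝ (Fin 3)) :
        EuclideanSpace ℝ (Fin 3) →L[ℝ] EuclideanSpace ℝ (Fin 3))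
      (Metric.ball 0 (δ ^ 2)) (1 / 2) := by
    intro y hy y' hy'
    obtain ⟨q, rfl⟩ := hopf_surjective y
    obtain ⟨q', rfl⟩ := hopf_surjective y'
    -- Passing to the aligned representative turns the error max(|q|,|s|) |q - s| into at most |q +
    -- s| |q - s| = |hopf q - hopf s|.
    obtain ⟨z, h1, -, h3, h4⟩ := exists_aligned_rotate q q'
    rw [← hopf_rotate_one z q'] at hy' h1 ⊢
    set s := rotate 1 z q'
    have hq := (hmem q).2 hy
    have hs := (hmem s).2 hy'
    have hsq : ‖s‖ = ‖q'‖ := norm_rotate 1 z q'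
    have hl := hlip q (hb₁ hq) s (hb₁ hs)
    have e : F (hopf q) - F (hopf s) - (hopf q - hopf s) =
        c⁻¹ • (f q - f s - c • (hopf q - hopf s)) := by
      rw [hfF q hq, hfF s hs]
      simp only [smul_sub, inv_smul_smul₀ hc]
    simp only [ContinuousLinearEquiv.coe_coe, ContinuousLinearEquiv.refl_apply]
    rw [e, norm_smul, h1, norm_inv, Real.norm_eq_abs, inv_mul_le_iff₀ (abs_pos.2 hc)]
    refine hl.trans ?_
    have : max ‖q‖ ‖s‖ ≤ ‖q + s‖ := max_le h3 (hsq ▸ h4)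
    calc |c| / 2 * max ‖q‖ ‖s‖ * ‖q - s‖ ≤ |c| / 2 * ‖q + s‖ * ‖q - s‖ := by gcongr
      _ = _ := by push_cast; ring
  have hN : (1 / 2 : NNReal) < ‖((ContinuousLinearEquiv.refl ℝ (EuclideanSpace ℝ (Fin 3))).symm :
      EuclideanSpace ℝ (Fin 3) →L[ℝ] EuclideanSpace ℝ (Fin 3))‖₊⁻¹ := by
    have : ‖((ContinuousLinearEquiv.refl ℝ (EuclideanSpace ℝ (Fin 3))).symm :
      EuclideanSpace ℝ (Fin 3) →L[ℝ] EuclideanSpace ℝ (Fin 3))‖₊ = 1 := by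
      rw [← NNReal.coe_inj]
      exact ContinuousLinearMap.norm_id
    rw [this, inv_one, ← NNReal.coe_lt_coe]
    norm_num
  set G := happ.toOpenPartialHomeomorph F (Metric.ball 0 (δ ^ 2)) (Or.inr hN) Metric.isOpen_ball
  refine ⟨δ, hδ0, min_le_right _ _, ?_, ?_, ?_⟩
  · refine ContinuousOn.congr (f := fun q => c • F (hopf q)) ?_ hfF
    exact (happ.continuousOn.comp continuous_hopf.continuousOn fun q hq => (hmem q).1 hq).const_smul c
  · intro q hq q' hq' h
    rw [hfF q hq, hfF q' hq'] at h
    exact exists_rotate_of_hopf_eq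
      (happ.injOn (Or.inr hN) ((hmem q).1 hq) ((hmem q').1 hq') (smul_right_injective _ hc h))
  · intro V hV hVo
    have e : f '' V = (fun y => c • y) '' (G '' (hopf '' V)) := by
      rw [Set.image_image, Set.image_image]
      exact Set.image_congr fun q hq => hfF q (hV hq)
    rw [e]
    refine (Homeomorph.smulOfNeZero c hc).isOpenMap _ (G.isOpen_image_of_subset_source
      (isOpenMap_hopf V hVo) ?_)
    rintro _ ⟨q, hq, rfl⟩
    exact (hmem q).1 (hV hq)

/-! ### Smooth dependence of integrals on parameters -/

section Parametric

variable {E : Type*} [NormedAddCommGroup E] [NormedSpace ℝ E]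
  {G : Type*} [NormedAddCommGroup G] [NormedSpace ℝ G]

lemma contDiffOn_fderiv_right {f : ℝ → E → G} {W : Set E} (hW : IsOpen W) {m n : ℕ∞ω}
    (hf : ContDiffOn ℝ n (Function.uncurry f) (Set.univ ×ˢ W)) (hmn : m + 1 ≤ n) :
    ContDiffOn ℝ m (fun p : ℝ × E => fderiv ℝ (f p.1) p.2) (Set.univ ×ˢ W) := by
  intro p hp
  refine ContDiffAt.contDiffWithinAt ?_
  have h1 : ContDiffAt ℝ n (Function.uncurry f) (p.1, p.2) :=
    hf.contDiffAt ((isOpen_univ.prod hW).mem_nhds hp)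
  refine ContDiffAt.fderiv (f := fun p : ℝ × E => f p.1) (g := Prod.snd) ?_ contDiffAt_snd hmn
  exact ContDiffAt.comp (p, p.2) (g := Function.uncurry f)
    (f := fun x : (ℝ × E) × E => (x.1.1, x.2)) h1 (by fun_prop)

/-- The derivative in y is jointly continuous, hence bounded on the compact product of the interval
with a small closed ball, and this constant dominates. -/
lemma hasFDerivAt_intervalIntegral [FiniteDimensional ℝ E] {f : ℝ → E → G} {W : Set E}
    (hW : IsOpen W) (hf : ContDiffOn ℝ 1 (Function.uncurry f) (Set.univ ×ˢ W)) (a b : ℝ) {y : E}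
    (hy : y ∈ W) :
    HasFDerivAt (fun y => ∫ t in a..b, f t y) (∫ t in a..b, fderiv ℝ (f t) y) y := by
  have hf' : ContinuousOn (fun p : ℝ × E => fderiv ℝ (f p.1) p.2) (Set.univ ×ˢ W) :=
    (contDiffOn_fderiv_right (m := 0) hW hf (by simp)).continuousOn
  obtain ⟨r, hr, hrW⟩ := Metric.nhds_basis_closedBall.mem_iff.1 (hW.mem_nhds hy)
  obtain ⟨C, hC⟩ := ((isCompact_uIcc (a := a) (b := b)).prod
    (isCompact_closedBall y r)).exists_bound_of_continuousOn
    (hf'.mono (Set.prod_mono (Set.subset_univ _) hrW))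
  have hcont : ∀ x ∈ W, Continuous fun t => f t x := fun x hx =>
    hf.continuousOn.comp_continuous (f := fun t : ℝ => (t, x)) (by fun_prop) fun t => ⟨trivial, hx⟩
  have hcont' : Continuous fun t => fderiv ℝ (f t) y :=
    hf'.comp_continuous (f := fun t : ℝ => (t, y)) (by fun_prop) fun t => ⟨trivial, hy⟩
  refine intervalIntegral.hasFDerivAt_integral_of_dominated_of_fderiv_le
    (F := fun y t => f t y) (F' := fun y t => fderiv ℝ (f t) y) (bound := fun _ => C)
    (Metric.closedBall_mem_nhds y hr) ?_ ((hcont y hy).intervalIntegrable _ _)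
    hcont'.aestronglyMeasurable ?_ intervalIntegrable_const ?_
  · filter_upwards [hW.mem_nhds hy] with x hx using (hcont x hx).aestronglyMeasurable
  · exact Filter.Eventually.of_forall fun t ht x hx => hC (t, x) ⟨Set.uIoc_subset_uIcc ht, hx⟩
  · refine Filter.Eventually.of_forall fun t ht x hx => ?_
    have h1 : ContDiffAt ℝ 1 (Function.uncurry f) (t, x) :=
      hf.contDiffAt ((isOpen_univ.prod hW).mem_nhds ⟨trivial, hrW hx⟩)
    have h2 : ContDiffAt ℝ 1 (f t) x :=
      ContDiffAt.comp x (g := Function.uncurry f) (f := fun x : E => (t, x)) h1 (by fun_prop)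
    exact (h2.differentiableAt one_ne_zero).hasFDerivAt

universe u

/-- Induction on the order: the derivative is again such an integral, with values in E →L[ℝ] G. The
target is therefore quantified inside the induction, and E and G share a universe so that E →L[ℝ] G
stays in it. -/
lemma contDiffOn_intervalIntegral_nat {E : Type u} [NormedAddCommGroup E] [NormedSpace ℝ E]
    [FiniteDimensional ℝ E] (n : ℕ) :
    ∀ {G : Type u} [NormedAddCommGroup G] [NormedSpace ℝ G] {f : ℝ → E → G} {W : Set E},
      IsOpen W → ContDiffOn ℝ ∞ (Function.uncurry f) (Set.univ ×ˢ W) → ∀ a b : ℝ,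
      ContDiffOn ℝ n (fun y => ∫ t in a..b, f t y) W := by
  induction n with
  | zero =>
    intro G _ _ f W hW hf a b
    rw [Nat.cast_zero, contDiffOn_zero]
    exact fun y hy => (hasFDerivAt_intervalIntegral hW (hf.of_le (by simp)) a b
      hy).continuousAt.continuousWithinAt
  | succ n ih =>
    intro G _ _ f W hW hf a b
    have hd := fun y hy => hasFDerivAt_intervalIntegral hW (hf.of_le (by simp)) a b (y := y) hy
    rw [Nat.cast_succ, contDiffOn_succ_iff_fderiv_of_isOpen hW]
    refine ⟨fun y hy => (hd y hy).differentiableAt.differentiableWithinAt, by simp, ?_⟩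
    exact (ih hW (f := fun t y => fderiv ℝ (f t) y)
      (contDiffOn_fderiv_right hW hf (by simp)) a b).congr fun y hy => (hd y hy).fderiv

lemma contDiffOn_intervalIntegral {E G : Type u} [NormedAddCommGroup E] [NormedSpace ℝ E]
    [NormedAddCommGroup G] [NormedSpace ℝ G] [FiniteDimensional ℝ E] {f : ℝ → E → G} {W : Set E}
    (hW : IsOpen W) (hf : ContDiffOn ℝ ∞ (Function.uncurry f) (Set.univ ×ˢ W)) (a b : ℝ) :
    ContDiffOn ℝ ∞ (fun y => ∫ t in a..b, f t y) W :=
  contDiffOn_infty.2 fun n => contDiffOn_intervalIntegral_nat n hW hf a b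

end Parametric

/-! ### Linearization of a circle flow at a fixed point by averaging -/

variable {E : Type*} [NormedAddCommGroup E] [NormedSpace ℝ E]

/-- A smooth circle action, written as a `2π`-periodic flow `a`, on an open set `W` of a vector
space, with fixed point `c`. -/
structure IsCircleFlow (a : ℝ → E → E) (W : Set E) (c : E) : Prop where
  isOpen : IsOpen W
  smooth : ContDiffOn ℝ ∞ (Function.uncurry a) (Set.univ ×ˢ W)
  mapsTo : ∀ t, ∀ y ∈ W, a t y ∈ W
  zero : ∀ y ∈ W, a 0 y = y
  add : ∀ s t, ∀ y ∈ W, a (s + t) y = a s (a t y)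
  periodic : ∀ t, ∀ y ∈ W, a (t + 2 * Real.pi) y = a t y
  mem : c ∈ W
  fixed : ∀ t, a t c = c

namespace IsCircleFlow

variable {a : ℝ → E → E} {W : Set E} {c : E}

lemma contDiffAt (h : IsCircleFlow a W c) (t : ℝ) {y : E} (hy : y ∈ W) :
    ContDiffAt ℝ ∞ (a t) y :=
  ContDiffAt.comp y (g := Function.uncurry a) (f := fun x : E => (t, x))
    (h.smooth.contDiffAt ((isOpen_univ.prod h.isOpen).mem_nhds ⟨trivial, hy⟩)) (by fun_prop)

lemma hasFDerivAt (h : IsCircleFlow a W c) (t : ℝ) {y : E} (hy : y ∈ W) :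
    HasFDerivAt (a t) (fderiv ℝ (a t) y) y :=
  ((h.contDiffAt t hy).differentiableAt (by simp)).hasFDerivAt

lemma fderiv_zero (h : IsCircleFlow a W c) : fderiv ℝ (a 0) c = ContinuousLinearMap.id ℝ E := by
  have : a 0 =ᶠ[𝓝 c] id := by
    filter_upwards [h.isOpen.mem_nhds h.mem] with y hy using h.zero y hy
  rw [this.fderiv_eq, fderiv_id]

lemma fderiv_add (h : IsCircleFlow a W c) (s t : ℝ) :
    fderiv ℝ (a (s + t)) c = (fderiv ℝ (a s) c).comp (fderiv ℝ (a t) c) := by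
  have : a (s + t) =ᶠ[𝓝 c] a s ∘ a t := by
    filter_upwards [h.isOpen.mem_nhds h.mem] with y hy using h.add s t y hy
  rw [this.fderiv_eq]
  have h1 := h.hasFDerivAt s h.mem
  rw [← h.fixed t] at h1
  have h2 := (h1.comp c (h.hasFDerivAt t h.mem)).fderiv
  rw [h2, h.fixed t]

lemma fderiv_periodic (h : IsCircleFlow a W c) (t : ℝ) :
    fderiv ℝ (a (t + 2 * Real.pi)) c = fderiv ℝ (a t) c := by
  refine Filter.EventuallyEq.fderiv_eq ?_
  filter_upwards [h.isOpen.mem_nhds h.mem] with y hy using h.periodic t y hy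

lemma contDiff_fderiv (h : IsCircleFlow a W c) : ContDiff ℝ ∞ fun t => fderiv ℝ (a t) c := by
  have h1 := contDiffOn_fderiv_right (m := ∞) h.isOpen h.smooth (by simp)
  rw [← contDiffOn_univ]
  exact h1.comp (f := fun t : ℝ => (t, c)) (by fun_prop) fun t _ => ⟨trivial, h.mem⟩

/-- The average of the translates of the identity chart, which linearizes the action. -/
def average (a : ℝ → E → E) (c : E) (y : E) : E :=
  (2 * Real.pi)⁻¹ • ∫ t in 0..(2 * Real.pi), fderiv ℝ (a (-t)) c (a t y - c)

lemma contDiffOn_integrand (h : IsCircleFlow a W c) :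
    ContDiffOn ℝ ∞ (Function.uncurry fun t y => fderiv ℝ (a (-t)) c (a t y - c))
      (Set.univ ×ˢ W) := by
  refine ContDiffOn.clm_apply (f := fun p : ℝ × E => fderiv ℝ (a (-p.1)) c)
    (g := fun p : ℝ × E => a p.1 p.2 - c) ?_ (h.smooth.sub contDiffOn_const)
  exact (h.contDiff_fderiv.comp (f := fun p : ℝ × E => -p.1) (by fun_prop)).contDiffOn

lemma contDiffOn_average [FiniteDimensional ℝ E] (h : IsCircleFlow a W c) :
    ContDiffOn ℝ ∞ (average a c) W :=
  (contDiffOn_intervalIntegral h.isOpen h.contDiffOn_integrand _ _).const_smul _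

lemma average_fixed (h : IsCircleFlow a W c) : average a c c = 0 := by
  simp [average, h.fixed]

/-- Substitute t + s for t in the average: the integrand is periodic, so the shift does not change
the integral, and da(s) factors out. -/
lemma average_flow [FiniteDimensional ℝ E] (h : IsCircleFlow a W c) (s : ℝ) {y : E} (hy : y ∈ W) :
    average a c (a s y) = fderiv ℝ (a s) c (average a c y) := by
  set F : ℝ → E := fun t => fderiv ℝ (a (-t)) c (a t y - c) with hF
  have hFc : Continuous F := h.contDiffOn_integrand.continuousOn.comp_continuous
    (f := fun t : ℝ => (t, y)) (by fun_prop) fun t => ⟨trivial, hy⟩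
  have hper : Function.Periodic F (2 * Real.pi) := by
    intro t
    simp only [hF]
    rw [h.periodic t y hy, ← h.fderiv_periodic (-(t + 2 * Real.pi))]
    congr 4
    ring
  have e : ∀ t, fderiv ℝ (a (-t)) c (a t (a s y) - c) = fderiv ℝ (a s) c (F (t + s)) := by
    intro t
    simp only [hF]
    rw [← h.add t s y hy, ← ContinuousLinearMap.comp_apply, ← h.fderiv_add]
    congr 4
    ring
  simp only [average, e]
  rw [map_smul, intervalIntegral.integral_comp_add_right (fun t => fderiv ℝ (a s) c (F t)) s,
    ContinuousLinearMap.intervalIntegral_comp_comm _ (hFc.intervalIntegrable _ _), zero_add,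
    add_comm (2 * Real.pi) s, hper.intervalIntegral_add_eq s 0, zero_add]

/-- Each integrand has derivative da(-t) ∘ da(t) = id at the fixed point, so the average does too,
and the inverse function theorem applies. -/
lemma hasFDerivAt_average [FiniteDimensional ℝ E] (h : IsCircleFlow a W c) :
    HasFDerivAt (average a c) (ContinuousLinearMap.id ℝ E) c := by
  have h1 := (hasFDerivAt_intervalIntegral h.isOpen (h.contDiffOn_integrand.of_le (by simp)) 0
    (2 * Real.pi) h.mem).const_smul (2 * Real.pi)⁻¹
  have h2 : ∀ t, fderiv ℝ (fun y => fderiv ℝ (a (-t)) c (a t y - c)) c =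
      ContinuousLinearMap.id ℝ E := by
    intro t
    have h3 := HasFDerivAt.comp (f := fun y => a t y - c) c
      ((fderiv ℝ (a (-t)) c).hasFDerivAt (x := a t c - c)) ((h.hasFDerivAt t h.mem).sub_const c)
    have h4 := h3.fderiv
    rw [← h.fderiv_add, neg_add_cancel, h.fderiv_zero] at h4
    exact h4
  simp only [h2, intervalIntegral.integral_const, sub_zero] at h1
  rwa [inv_smul_smul₀ (by positivity)] at h1

/-- Tube lemma over one compact period. It provides the invariant open neighbourhoods. -/
lemma eventually_forall_mem (h : IsCircleFlow a W c) {s : Set E} (hs : IsOpen s) {y : E}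
    (hy : y ∈ W) (hys : ∀ t, a t y ∈ s) : ∀ᶠ x in 𝓝 y, ∀ t, a t x ∈ s := by
  have h1 : ∀ᶠ x in 𝓝 y, ∀ t ∈ Set.Icc 0 (2 * Real.pi), a t x ∈ s := by
    refine isCompact_Icc.eventually_forall_of_forall_eventually fun t _ => ?_
    have hc : ContinuousAt (Function.uncurry a ∘ Prod.swap) (y, t) :=
      ContinuousAt.comp (h.smooth.continuousOn.continuousAt
        ((isOpen_univ.prod h.isOpen).mem_nhds ⟨trivial, hy⟩)) continuous_swap.continuousAt
    exact hc.preimage_mem_nhds (hs.mem_nhds (hys t))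
  filter_upwards [h1, h.isOpen.mem_nhds hy] with x hx hxW t
  have hper : Function.Periodic (fun t => a t x) (2 * Real.pi) := fun t => h.periodic t x hxW
  obtain ⟨t', ht', e⟩ := hper.exists_mem_Ico₀ (by positivity) t
  rw [e]
  exact hx t' ⟨ht'.1, ht'.2.le⟩

/-- A circle action is linear in suitable coordinates near a fixed point. -/
lemma exists_linearization [FiniteDimensional ℝ E] (h : IsCircleFlow a W c) :
    ∃ Φ : OpenPartialHomeomorph E E, 0 ∈ Φ.source ∧ Φ 0 = c ∧ Φ.target ⊆ W ∧
      ContDiffOn ℝ ∞ Φ Φ.source ∧ ContDiffOn ℝ ∞ Φ.symm Φ.target ∧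
      ∀ v ∈ Φ.source, ∀ t, fderiv ℝ (a t) c v ∈ Φ.source ∧ Φ (fderiv ℝ (a t) c v) = a t (Φ v) := by
  have hsm := h.contDiffOn_average
  have hsmc : ContDiffAt ℝ ∞ (average a c) c := hsm.contDiffAt (h.isOpen.mem_nhds h.mem)
  have hd : HasFDerivAt (average a c)
      ((ContinuousLinearEquiv.refl ℝ E : E ≃L[ℝ] E) : E →L[ℝ] E) c := h.hasFDerivAt_average
  set Ψ := hsmc.toOpenPartialHomeomorph (average a c) hd (by simp) with hΨ
  have hΨc : c ∈ Ψ.source := hsmc.mem_toOpenPartialHomeomorph_source hd (by simp)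
  have hcoe : (Ψ : E → E) = average a c := rfl
  -- Smoothness of the inverse at every point requires an invertible derivative there, not only at
  -- c. Invertible maps form an open set, so this holds near c.
  obtain ⟨s, hsub, hso, hcs⟩ : ∃ s ⊆ Ψ.source ∩ W ∩ {y | ∃ L : E ≃L[ℝ] E, 
      (L : E →L[ℝ] E) = fderiv ℝ (average a c) y}, IsOpen s ∧ c ∈ s := by
    refine mem_nhds_iff.1 (Filter.inter_mem (Filter.inter_mem (Ψ.open_source.mem_nhds hΨc)
      (h.isOpen.mem_nhds h.mem)) ?_)
    have hc := (hsmc.continuousAt_fderiv (by simp)).preimage_mem_nhds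
      (t := Set.range ((↑) : (E ≃L[ℝ] E) → E →L[ℝ] E)) (by
        rw [hd.fderiv]
        exact ContinuousLinearEquiv.nhds _)
    exact hc
  -- The points whose whole orbit stays in s: an invariant open neighbourhood of c, whose image
  -- under the average is invariant under the linear action.
  set N : Set E := {y | y ∈ W ∧ ∀ t, a t y ∈ s} with hN
  have hNo : IsOpen N := by
    rw [isOpen_iff_mem_nhds]
    intro y hy
    filter_upwards [h.isOpen.mem_nhds hy.1, h.eventually_forall_mem hso hy.1 hy.2] with x h1 h2
      using ⟨h1, h2⟩
  have hNs : N ⊆ s := fun y hy => h.zero y hy.1 ▸ hy.2 0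
  have hcN : c ∈ N := ⟨h.mem, fun t => by rwa [h.fixed t]⟩
  have hNinv : ∀ y ∈ N, ∀ t, a t y ∈ N := fun y hy t =>
    ⟨h.mapsTo t y hy.1, fun t' => by rw [← h.add t' t y hy.1]; exact hy.2 _⟩
  set Θ := Ψ.restrOpen N hNo with hΘ
  have hΘs : Θ.source = N := by
    rw [hΘ, OpenPartialHomeomorph.restrOpen_source]
    exact Set.inter_eq_right.2 fun y hy => (hsub (hNs hy)).1.1
  have hΘc : ∀ y, Θ y = average a c y := fun y => rfl
  refine ⟨Θ.symm, ?_, ?_, ?_, ?_, ?_, ?_⟩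
  · have := Θ.map_source (hΘs ▸ hcN)
    rwa [hΘc, h.average_fixed] at this
  · rw [← h.average_fixed, ← hΘc]
    exact Θ.left_inv (hΘs ▸ hcN)
  · rw [OpenPartialHomeomorph.symm_target, hΘs]
    exact fun y hy => hy.1
  · intro v hv
    have hv' : Θ.symm v ∈ N := hΘs ▸ Θ.map_target hv
    have hm := hsub (hNs hv')
    obtain ⟨L, hL⟩ := hm.2
    refine (Θ.contDiffAt_symm (f₀' := L) hv ?_ ?_).contDiffWithinAt
    · rw [hL]
      exact ((hsm.contDiffAt (h.isOpen.mem_nhds hm.1.2)).differentiableAt (by simp)).hasFDerivAt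
    · exact hsm.contDiffAt (h.isOpen.mem_nhds hm.1.2)
  · rw [OpenPartialHomeomorph.symm_target, OpenPartialHomeomorph.symm_symm, hΘs]
    exact hsm.mono fun y hy => hy.1
  · intro v hv t
    have hy : Θ.symm v ∈ N := hΘs ▸ Θ.map_target hv
    have e : fderiv ℝ (a t) c v = Θ (a t (Θ.symm v)) := by
      rw [hΘc, h.average_flow t hy.1, ← hΘc, Θ.right_inv hv]
    rw [e]
    have hmem : a t (Θ.symm v) ∈ Θ.source := hΘs ▸ hNinv _ hy t
    exact ⟨Θ.map_source hmem, Θ.left_inv hmem⟩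

end IsCircleFlow

/-! ### Linearizing parametrizations on the manifold and effectiveness -/

section Manifold

variable {E : Type*} [NormedAddCommGroup E] [NormedSpace ℝ E]
  {M : Type*} [TopologicalSpace M] [ChartedSpace E M]

/-- `e` is a smooth parametrization near the fixed point `p` in which the circle action is the
linear action `ρ`. -/
structure IsLinearization [SMul Circle M] (p : M) (e : OpenPartialHomeomorph E M)
    (ρ : ℝ → E →L[ℝ] E) : Prop where
  zero_mem : 0 ∈ e.source
  map_zero : e 0 = p
  smooth : ContMDiffOn 𝓘(ℝ, E) 𝓘(ℝ, E) ∞ e e.source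
  smooth_symm : ContMDiffOn 𝓘(ℝ, E) 𝓘(ℝ, E) ∞ e.symm e.target
  mem : ∀ v ∈ e.source, ∀ t, ρ t v ∈ e.source
  equivariant : ∀ v ∈ e.source, ∀ t, e (ρ t v) = Circle.exp t • e v
  contDiff : ContDiff ℝ ∞ ρ
  zero : ρ 0 = ContinuousLinearMap.id ℝ E
  add : ∀ s t, ρ (s + t) = (ρ s).comp (ρ t)
  periodic : ∀ t, ρ (t + 2 * Real.pi) = ρ t

lemma continuous_smul_circle (E : Type*) [NormedAddCommGroup E] [NormedSpace ℝ E]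
    {M : Type*} [TopologicalSpace M] [ChartedSpace E M] [MulAction Circle M]
    [ContMDiffSMul (𝓡 1) 𝓘(ℝ, E) ∞ Circle M] : Continuous fun p : Circle × M => p.1 • p.2 :=
  (contMDiff_smul (I := 𝓡 1) (I' := 𝓘(ℝ, E)) (n := ∞) (G := Circle) (M := M)).continuous

variable [IsManifold 𝓘(ℝ, E) ∞ M] [MulAction Circle M] [ContMDiffSMul (𝓡 1) 𝓘(ℝ, E) ∞ Circle M]

/-- The chart domain is not invariant, so it is cut down to the points whose entire orbit lies in
it; this set is open because the circle is compact. -/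
lemma isCircleFlow_chart {p : M} (hp : ∀ z : Circle, z • p = p) :
    IsCircleFlow (fun t y => chartAt E p (Circle.exp t • (chartAt E p).symm y))
      ((chartAt E p).target ∩ (chartAt E p).symm ⁻¹'
        {x | ∀ z : Circle, z • x ∈ (chartAt E p).source}) (chartAt E p p) := by
  set χ := chartAt E p with hχ
  set V : Set M := {x | ∀ z : Circle, z • x ∈ χ.source} with hV
  have hVs : V ⊆ χ.source := fun x hx => by simpa using hx 1
  have hVo : IsOpen V := by
    rw [isOpen_iff_mem_nhds]
    intro x hx
    have h1 : ∀ᶠ y in 𝓝 x, ∀ z ∈ (Set.univ : Set Circle), z • y ∈ χ.source := by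
      refine isCompact_univ.eventually_forall_of_forall_eventually fun z _ => ?_
      have hc : Continuous fun q : M × Circle => q.2 • q.1 :=
        (continuous_smul_circle E).comp continuous_swap
      exact hc.continuousAt.preimage_mem_nhds (χ.open_source.mem_nhds (hx z))
    filter_upwards [h1] with y hy z using hy z trivial
  have hVi : ∀ x ∈ V, ∀ z : Circle, z • x ∈ V := fun x hx z z' => by
    rw [smul_smul]; exact hx _
  have hpV : p ∈ V := fun z => by rw [hp z]; exact mem_chart_source E p
  have hp' : χ.symm (χ p) = p := χ.left_inv (mem_chart_source E p)
  have hsymm : ∀ t, ∀ y ∈ χ.target ∩ χ.symm ⁻¹' V,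
      χ.symm (χ (Circle.exp t • χ.symm y)) = Circle.exp t • χ.symm y :=
    fun t y hy => χ.left_inv (hVs (hVi _ hy.2 _))
  refine ⟨χ.isOpen_inter_preimage_symm hVo, ?_, ?_, ?_, ?_, ?_, ?_, ?_⟩
  · rw [← contMDiffOn_iff_contDiffOn]
    have h1 : ContMDiffOn 𝓘(ℝ, ℝ × E) 𝓘(ℝ, E) ∞ (fun q : ℝ × E => χ.symm q.2)
        (Set.univ ×ˢ (χ.target ∩ χ.symm ⁻¹' V)) :=
      (contMDiffOn_chart_symm (I := 𝓘(ℝ, E)) (n := ∞) (x := p)).comp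
        (contDiff_snd (𝕜 := ℝ) (E := ℝ) (F := E)).contMDiff.contMDiffOn fun q hq => hq.2.1
    have h2 : ContMDiffOn 𝓘(ℝ, ℝ × E) (𝓡 1) ∞ (fun q : ℝ × E => Circle.exp q.1)
        (Set.univ ×ˢ (χ.target ∩ χ.symm ⁻¹' V)) :=
      (contMDiff_circleExp.comp
        (contDiff_fst (𝕜 := ℝ) (E := ℝ) (F := E)).contMDiff).contMDiffOn
    exact (contMDiffOn_chart (I := 𝓘(ℝ, E)) (n := ∞) (x := p)).comp (h2.smul h1)
      fun q hq => hVs (hVi _ hq.2.2 _)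
  · intro t y hy
    refine ⟨χ.map_source (hVs (hVi _ hy.2 _)), ?_⟩
    rw [Set.mem_preimage, hsymm t y hy]
    exact hVi _ hy.2 _
  · intro y hy
    simp only [Circle.exp_zero, one_smul]
    exact χ.right_inv hy.1
  · intro s t y hy
    simp only [hsymm t y hy, Circle.exp_add, smul_smul]
  · intro t y hy
    simp only [Circle.exp_add, Circle.exp_two_pi, mul_one]
  · exact ⟨χ.map_source (mem_chart_source E p), by rw [Set.mem_preimage, hp']; exact hpV⟩
  · intro t
    simp only [hp', hp]

lemma exists_isLinearization [FiniteDimensional ℝ E] {p : M} (hp : ∀ z : Circle, z • p = p) :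
    ∃ (e : OpenPartialHomeomorph E M) (ρ : ℝ → E →L[ℝ] E), IsLinearization p e ρ := by
  have h := isCircleFlow_chart (E := E) hp
  obtain ⟨Φ, h0, h0c, htar, hsm, hsm', heq⟩ := h.exists_linearization
  set χ := chartAt E p with hχ
  have hsrc : (Φ.trans χ.symm).source = Φ.source := by
    rw [OpenPartialHomeomorph.trans_source, Set.inter_eq_left]
    exact fun v hv => (htar (Φ.map_source hv)).1
  refine ⟨Φ.trans χ.symm, _, ?_, ?_, ?_, ?_, ?_, ?_, h.contDiff_fderiv, h.fderiv_zero,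
    h.fderiv_add, h.fderiv_periodic⟩
  · rwa [hsrc]
  · rw [OpenPartialHomeomorph.trans_apply, h0c]
    exact χ.left_inv (mem_chart_source E p)
  · rw [hsrc]
    exact (contMDiffOn_chart_symm (I := 𝓘(ℝ, E)) (n := ∞) (x := p)).comp
      (contMDiffOn_iff_contDiffOn.2 hsm) fun v hv => (htar (Φ.map_source hv)).1
  · refine (contMDiffOn_iff_contDiffOn.2 hsm').comp
      ((contMDiffOn_chart (I := 𝓘(ℝ, E)) (n := ∞) (x := p)).mono ?_) ?_
    · intro x hx
      rw [OpenPartialHomeomorph.trans_target] at hx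
      exact hx.1
    · intro x hx
      rw [OpenPartialHomeomorph.trans_target] at hx
      exact hx.2
  · intro v hv t
    rw [hsrc] at hv ⊢
    exact (heq v hv t).1
  · intro v hv t
    rw [hsrc] at hv
    rw [OpenPartialHomeomorph.trans_apply, OpenPartialHomeomorph.trans_apply, (heq v hv t).2]
    exact χ.left_inv ((htar (Φ.map_source hv)).2 _)

namespace IsLinearization

variable {p : M} {e : OpenPartialHomeomorph E M} {ρ : ℝ → E →L[ℝ] E}

/-- The kernel of ρ t - id contains a non-empty open set, so it is the whole space. -/
lemma eq_id_of_fixed (h : IsLinearization p e ρ) {U : Set M} (hU : IsOpen U)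
    (hUe : (U ∩ e.target).Nonempty) (hfix : ∀ x ∈ U, ∀ z : Circle, z • x = x) (t : ℝ) :
    ρ t = ContinuousLinearMap.id ℝ E := by
  have ho : IsOpen (e.source ∩ e ⁻¹' U) := e.isOpen_inter_preimage hU
  have hsub : e.source ∩ e ⁻¹' U ⊆
      (LinearMap.ker ((ρ t - ContinuousLinearMap.id ℝ E : E →L[ℝ] E) : E →ₗ[ℝ] E) : Set E) := by
    intro v hv
    have h1 : e (ρ t v) = e v := by rw [h.equivariant v hv.1, hfix _ hv.2]
    have h2 := e.injOn (h.mem v hv.1 t) hv.1 h1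
    simp [h2]
  obtain ⟨x, hxU, hxe⟩ := hUe
  have htop := Submodule.eq_top_of_nonempty_interior'
    (LinearMap.ker ((ρ t - ContinuousLinearMap.id ℝ E : E →L[ℝ] E) : E →ₗ[ℝ] E))
    ⟨e.symm x, mem_interior.2 ⟨_, hsub, ho, e.map_target hxe, by
      rw [Set.mem_preimage, e.right_inv hxe]; exact hxU⟩⟩
  ext v
  have : v ∈ LinearMap.ker ((ρ t - ContinuousLinearMap.id ℝ E : E →L[ℝ] E) : E →ₗ[ℝ] E) := by
    rw [htop]; trivial
  simpa [sub_eq_zero] using this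

lemma fixed_of_eq_id (h : IsLinearization p e ρ)
    (hρ : ∀ t, ρ t = ContinuousLinearMap.id ℝ E) {x : M} (hx : x ∈ e.target) (z : Circle) :
    z • x = x := by
  obtain ⟨t, rfl⟩ := Circle.exp_surjective z
  have := h.equivariant _ (e.map_target hx) t
  rw [hρ, ContinuousLinearMap.id_apply, e.right_inv hx] at this
  exact this.symm

lemma mem_target (h : IsLinearization p e ρ) : p ∈ e.target :=
  h.map_zero ▸ e.map_source h.zero_mem

/-- For an effective action on a connected manifold, all isotropy representations at fixed
points are nontrivial. -/
lemma exists_ne_id [FiniteDimensional ℝ E] [T2Space M] [ConnectedSpace M]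
    [FaithfulSMul Circle M] (h : IsLinearization p e ρ) :
    ∃ t, ρ t ≠ ContinuousLinearMap.id ℝ E := by
  by_contra! hρ
  set F : Set M := {x | ∀ z : Circle, z • x = x} with hF
  have hFc : IsClosed F := by
    rw [hF, Set.ofPred_forall]
    refine isClosed_iInter fun z => isClosed_eq ?_ continuous_id
    exact (continuous_smul_circle E).comp (f := fun x : M => (z, x)) (by fun_prop)
  -- A limit x of interior points of F is fixed, so the action can be linearized at x. Interior
  -- points of F nearby force that linear action to be trivial, whence x is interior. Connectedness
  -- then makes the whole action trivial.
  have hclosed : IsClosed (interior F) := by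
    refine isClosed_of_closure_subset fun x hx => ?_
    have hxF : x ∈ F := hFc.closure_subset_iff.2 interior_subset hx
    obtain ⟨e', ρ', h'⟩ := exists_isLinearization (E := E) hxF
    have hne : (interior F ∩ e'.target).Nonempty := by
      rw [Set.inter_comm]
      exact mem_closure_iff.1 hx _ e'.open_target h'.mem_target
    have hid := h'.eq_id_of_fixed isOpen_interior hne fun y hy => interior_subset hy
    exact mem_interior.2 ⟨e'.target, fun y hy z => h'.fixed_of_eq_id hid hy z, e'.open_target,
      h'.mem_target⟩
  have huniv : interior F = Set.univ := by
    refine IsClopen.eq_univ ⟨hclosed, isOpen_interior⟩ ⟨p, mem_interior.2 ⟨e.target, ?_,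
      e.open_target, h.mem_target⟩⟩
    exact fun y hy z => h.fixed_of_eq_id hρ hy z
  obtain ⟨z, hz⟩ : ∃ z : Circle, z ≠ 1 := by
    refine ⟨Circle.exp Real.pi, fun h1 => ?_⟩
    have h2 := congrArg (fun z : Circle => (z : ℂ).re) h1
    norm_num [Circle.coe_exp, Complex.exp_pi_mul_I] at h2
  refine hz (FaithfulSMul.eq_of_smul_eq_smul (α := M) fun x => ?_)
  have hx : x ∈ F := interior_subset (huniv ▸ Set.mem_univ x)
  rw [hx z, one_smul]

end IsLinearization

end Manifold

/-! ### Hyperhermitian circle representations and quaternionic lines -/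

section LinearAlgebra

/-- A nonzero operator that is symmetric for some inner product has a nonzero eigenvalue. -/
lemma exists_eigenvector_of_symmetric {V : Type*} [AddCommGroup V] [Module ℝ V]
    [FiniteDimensional ℝ V] (c : InnerProductSpace.Core ℝ V) (T : V →ₗ[ℝ] V)
    (hT : ∀ u v, c.inner (T u) v = c.inner u (T v)) (h0 : T ≠ 0) :
    ∃ (l : ℝ) (w : V), l ≠ 0 ∧ w ≠ 0 ∧ T w = l • w := by
  let _ : NormedAddCommGroup V := c.toNormedAddCommGroup
  let _ : InnerProductSpace ℝ V := InnerProductSpace.ofCore c.toCore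
  have hs : T.IsSymmetric := hT
  by_contra! hcon
  refine h0 ((hs.eigenvectorBasis rfl).toBasis.ext fun i => ?_)
  have h1 := hs.apply_eigenvectorBasis rfl i
  have h2 : (hs.eigenvectorBasis rfl) i ≠ 0 := (hs.eigenvectorBasis rfl).toBasis.ne_zero i
  by_cases h3 : hs.eigenvalues rfl i = 0
  · rw [h3] at h1
    simpa using h1
  · exact absurd h1 (hcon _ _ h3 h2)

variable {E : Type*} [NormedAddCommGroup E] [NormedSpace ℝ E]

/-- A hyperhermitian structure on a vector space. -/
structure IsHyperhermitian (g : E →L[ℝ] E →L[ℝ] ℝ) (I J K : E →L[ℝ] E) : Prop where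
  symm : ∀ u v, g u v = g v u
  pos : ∀ u, u ≠ 0 → 0 < g u u
  sqI : ∀ u, I (I u) = -u
  sqJ : ∀ u, J (J u) = -u
  sqK : ∀ u, K (K u) = -u
  invI : ∀ u v, g (I u) (I v) = g u v
  invJ : ∀ u v, g (J u) (J v) = g u v
  invK : ∀ u v, g (K u) (K v) = g u v
  IJ : ∀ u, I (J u) = K u
  JI : ∀ u, J (I u) = -K u

/-- A smooth circle representation by hyperhermitian maps. -/
structure IsCircleRep (g : E →L[ℝ] E →L[ℝ] ℝ) (I J K : E →L[ℝ] E) (ρ : ℝ → E →L[ℝ] E) :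
    Prop where
  contDiff : ContDiff ℝ ∞ ρ
  zero : ρ 0 = ContinuousLinearMap.id ℝ E
  add : ∀ s t, ρ (s + t) = (ρ s).comp (ρ t)
  periodic : ∀ t, ρ (t + 2 * Real.pi) = ρ t
  isometric : ∀ t u v, g (ρ t u) (ρ t v) = g u v
  commI : ∀ t u, ρ t (I u) = I (ρ t u)
  commJ : ∀ t u, ρ t (J u) = J (ρ t u)
  commK : ∀ t u, ρ t (K u) = K (ρ t u)

variable {g : E →L[ℝ] E →L[ℝ] ℝ} {I J K : E →L[ℝ] E} {ρ : ℝ → E →L[ℝ] E}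

namespace IsHyperhermitian

lemma skewI (h : IsHyperhermitian g I J K) (u v : E) : g (I u) v = -g u (I v) := by
  have := h.invI u (I v)
  rw [h.sqI, map_neg] at this
  linarith

lemma skewJ (h : IsHyperhermitian g I J K) (u v : E) : g (J u) v = -g u (J v) := by
  have := h.invJ u (J v)
  rw [h.sqJ, map_neg] at this
  linarith

lemma skewK (h : IsHyperhermitian g I J K) (u v : E) : g (K u) v = -g u (K v) := by
  have := h.invK u (K v)
  rw [h.sqK, map_neg] at this
  linarith

lemma KI (h : IsHyperhermitian g I J K) (u : E) : K (I u) = J u := by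
  rw [← h.IJ, h.JI, map_neg, ← h.IJ, h.sqI, neg_neg]

lemma IK (h : IsHyperhermitian g I J K) (u : E) : I (K u) = -J u := by
  rw [← h.IJ, h.sqI]

lemma KJ (h : IsHyperhermitian g I J K) (u : E) : K (J u) = -I u := by
  rw [← h.IJ, h.sqJ, map_neg]

lemma JK (h : IsHyperhermitian g I J K) (u : E) : J (K u) = I u := by
  rw [← h.IJ, h.JI, h.KJ, neg_neg]

end IsHyperhermitian

/-- One-parameter group law: ρ(s) = ρ(t) ρ(s - t), differentiated at s = t. -/
lemma IsCircleRep.hasDerivAt (hρ : IsCircleRep g I J K ρ) (t : ℝ) :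
    HasDerivAt ρ ((ρ t).comp (deriv ρ 0)) t := by
  have h1 : HasDerivAt ρ (deriv ρ 0) (t - t) := by
    rw [sub_self]
    exact (hρ.contDiff.differentiable (by simp) 0).hasDerivAt
  have h2 : HasDerivAt (fun s => ρ (s - t)) (deriv ρ 0) t := by
    simpa using h1.comp_sub_const t t
  have h3 := (((ContinuousLinearMap.compL ℝ E E E) (ρ t)).hasFDerivAt).comp_hasDerivAt t h2
  have e : ρ = fun s => (ρ t).comp (ρ (s - t)) := by
    funext s
    rw [← hρ.add]
    congr 1
    ring
  exact h3.congr_of_eventuallyEq (Filter.Eventually.of_forall fun s => congrFun e s)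

lemma IsCircleRep.deriv_ne_zero (hρ : IsCircleRep g I J K ρ)
    (hne : ∃ t, ρ t ≠ ContinuousLinearMap.id ℝ E) : deriv ρ 0 ≠ 0 := by
  intro h0
  obtain ⟨t, ht⟩ := hne
  refine ht ?_
  rw [← hρ.zero]
  refine is_const_of_deriv_eq_zero (hρ.contDiff.differentiable (by simp)) (fun s => ?_) t 0
  rw [(hρ.hasDerivAt s).deriv, h0, ContinuousLinearMap.comp_zero]

lemma IsCircleRep.hasDerivAt_apply (hρ : IsCircleRep g I J K ρ) (t : ℝ) (u : E) :
    HasDerivAt (fun t => ρ t u) (ρ t (deriv ρ 0 u)) t :=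
  ((ContinuousLinearMap.apply ℝ E u).hasFDerivAt).comp_hasDerivAt t (hρ.hasDerivAt t)

lemma IsCircleRep.hasDerivAt_apply_zero (hρ : IsCircleRep g I J K ρ) (u : E) :
    HasDerivAt (fun t => ρ t u) (deriv ρ 0 u) 0 := by
  simpa [hρ.zero] using hρ.hasDerivAt_apply 0 u

/-- A nontrivial hyperhermitian circle representation has a vector of nonzero weight. -/
lemma IsCircleRep.exists_weight_vector [FiniteDimensional ℝ E] (h : IsHyperhermitian g I J K)
    (hρ : IsCircleRep g I J K ρ) (hne : ∃ t, ρ t ≠ ContinuousLinearMap.id ℝ E) :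
    ∃ (k : ℤ) (w : E), k ≠ 0 ∧ w ≠ 0 ∧
      ∀ t : ℝ, ρ t w = Real.cos (k * t) • w - Real.sin (k * t) • I w := by
  set D := deriv ρ 0 with hD
  have hD0 : D ≠ 0 := hρ.deriv_ne_zero hne
  have hDI : ∀ u, D (I u) = I (D u) := by
    intro u
    have h1 := hρ.hasDerivAt_apply_zero (I u)
    have h2 := (I.hasFDerivAt).comp_hasDerivAt (0 : ℝ) (hρ.hasDerivAt_apply_zero u)
    have e : (fun t => ρ t (I u)) = I ∘ fun t => ρ t u := funext fun t => hρ.commI t u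
    rw [e] at h1
    exact h1.unique h2
  have hDskew : ∀ u v, g (D u) v + g u (D v) = 0 := by
    intro u v
    have h1 := (g.hasFDerivAt.comp_hasDerivAt (0 : ℝ) (hρ.hasDerivAt_apply_zero u)).clm_apply
      (hρ.hasDerivAt_apply_zero v)
    have e : (fun t => (g ∘ fun t => ρ t u) t (ρ t v)) = fun _ => g u v :=
      funext fun t => hρ.isometric t u v
    rw [e] at h1
    have h2 := h1.unique (hasDerivAt_const 0 (g u v))
    simpa [hρ.zero] using h2
  let c : InnerProductSpace.Core ℝ E :=
    { inner := fun u v => g u v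
      conj_inner_symm := fun u v => by simpa using h.symm v u
      re_inner_nonneg := fun u => by
        by_cases hu : u = 0
        · simp [hu]
        · simpa using (h.pos u hu).le
      add_left := fun u v w => by simp
      smul_left := fun u v r => by simp
      definite := fun u hu => by
        by_contra hne
        exact (h.pos u hne).ne' hu }
  -- I and D are skew and commute, so ID is symmetric for g; it is non-zero because D is and I is
  -- invertible.
  obtain ⟨l, w, hl, hw, hlw⟩ := exists_eigenvector_of_symmetric c
    ((I.comp D : E →L[ℝ] E) : E →ₗ[ℝ] E) (fun u v => by
      change g (I (D u)) v = g u (I (D v))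
      rw [h.skewI, ← hDI]
      linarith [hDskew u (I v)]) (by
      intro h0
      refine hD0 (ContinuousLinearMap.ext fun u => ?_)
      have h1 : I (D u) = 0 := LinearMap.congr_fun h0 u
      have h2 := h.sqI (D u)
      rw [h1, map_zero] at h2
      simpa using h2.symm)
  have hDw : D w = -(l • I w) := by
    have h1 : I (D w) = l • w := hlw
    have h2 := h.sqI (D w)
    rw [h1, map_smul] at h2
    rw [h2, neg_neg]
  have hrot : ∀ t : ℝ, ρ t w = Real.cos (l * t) • w - Real.sin (l * t) • I w := by
    -- The curve ρ t w solves y' = -l I y. Undoing the expected rotation gives a curve with zero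
    -- derivative, which stays at its initial value w.
    have hz : ∀ t : ℝ, Real.cos (l * t) • ρ t w + Real.sin (l * t) • I (ρ t w) = w := by
      intro t
      have hy : ∀ t, HasDerivAt (fun t => ρ t w) (-(l • I (ρ t w))) t := by
        intro t
        have h1 := hρ.hasDerivAt_apply t w
        rwa [← hD, hDw, map_neg, map_smul, hρ.commI] at h1
      have hIy : ∀ t, HasDerivAt (fun t => I (ρ t w)) (l • ρ t w) t := by
        intro t
        have h1 := (I.hasFDerivAt).comp_hasDerivAt t (hy t)
        rw [map_neg, map_smul, h.sqI, smul_neg, neg_neg] at h1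
        exact h1
      have hlin : ∀ t : ℝ, HasDerivAt (fun t => l * t) l t := fun t => by
        simpa using (hasDerivAt_id t).const_mul l
      have hder : ∀ t : ℝ, HasDerivAt
          (fun t => Real.cos (l * t) • ρ t w + Real.sin (l * t) • I (ρ t w)) 0 t := by
        intro t
        refine (((hlin t).cos.smul (hy t)).add ((hlin t).sin.smul (hIy t))).congr_deriv ?_
        module
      have hc := is_const_of_deriv_eq_zero (fun t => (hder t).differentiableAt)
        (fun t => (hder t).deriv) t 0
      simpa [hρ.zero] using hc
    intro t
    have h1 := hz t
    have h2 := congrArg I h1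
    rw [map_add, map_smul, map_smul, h.sqI] at h2
    have h3 := Real.cos_sq_add_sin_sq (l * t)
    calc ρ t w = (Real.cos (l * t) ^ 2 + Real.sin (l * t) ^ 2) • ρ t w := by rw [h3, one_smul]
      _ = Real.cos (l * t) • (Real.cos (l * t) • ρ t w + Real.sin (l * t) • I (ρ t w)) -
          Real.sin (l * t) • (Real.cos (l * t) • I (ρ t w) + Real.sin (l * t) • -ρ t w) := by
        module
      _ = _ := by rw [h1, h2]
  -- Periodicity gives w = cos(2πl) w - sin(2πl) I w; pairing with w, which is orthogonal to I w,
  -- leaves cos(2πl) = 1.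
  have hint : ∃ k : ℤ, (k : ℝ) = l := by
    have h1 := hrot (2 * Real.pi)
    have h2 := hρ.periodic 0
    rw [zero_add, hρ.zero] at h2
    rw [h2, ContinuousLinearMap.id_apply] at h1
    have h3 : g (I w) w = 0 := by
      have := h.skewI w w
      rw [h.symm w (I w)] at this
      linarith
    have h4 := congrArg (fun v => g v w) h1
    simp only [map_sub, map_smul, sub_apply, smul_apply,
      h3, smul_eq_mul, mul_zero, sub_zero] at h4
    have h5 : Real.cos (l * (2 * Real.pi)) = 1 :=
      mul_right_cancel₀ (h.pos w hw).ne' (by rw [one_mul]; exact h4.symm)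
    obtain ⟨n, hn⟩ := (Real.cos_eq_one_iff _).1 h5
    exact ⟨n, mul_right_cancel₀ (by positivity : (2 * Real.pi) ≠ 0) hn⟩
  obtain ⟨k, rfl⟩ := hint
  exact ⟨k, w, by exact_mod_cast hl, hw, hrot⟩

/-- The quaternion line through `w`: right multiplication by `-i`, `-j`, `-k` becomes
`I`, `J`, `K`. -/
def quaternionLine (I J K : E →L[ℝ] E) (w : E) : ℍ →L[ℝ] E :=
  LinearMap.toContinuousLinearMap
    { toFun := fun q => q.re • w - q.imI • I w - q.imJ • J w - q.imK • K w
      map_add' := fun q q' => by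
        simp only [Quaternion.re_add, Quaternion.imI_add, Quaternion.imJ_add, Quaternion.imK_add]
        module
      map_smul' := fun r q => by
        simp only [Quaternion.re_smul, Quaternion.imI_smul, Quaternion.imJ_smul,
          Quaternion.imK_smul, RingHom.id_apply, smul_eq_mul]
        module }

lemma quaternionLine_apply (w : E) (q : ℍ) :
    quaternionLine I J K w q = q.re • w - q.imI • I w - q.imJ • J w - q.imK • K w := rfl

lemma mul_neg_qi (q : ℍ) : q * -qi = (⟨q.imI, -q.re, -q.imK, q.imJ⟩ : ℍ) := by
  ext <;> simp <;> simp [qi]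

lemma mul_neg_qj (q : ℍ) : q * -qj = (⟨q.imJ, q.imK, -q.re, -q.imI⟩ : ℍ) := by
  ext <;> simp <;> simp [qj]

lemma mul_neg_qk (q : ℍ) : q * -qk = (⟨q.imK, -q.imJ, q.imI, -q.re⟩ : ℍ) := by
  ext <;> simp <;> simp [qk]

lemma quaternionLine_mk (w : E) (a b c d : ℝ) :
    quaternionLine I J K w (⟨a, b, c, d⟩ : ℍ) = a • w - b • I w - c • J w - d • K w := rfl

lemma quaternionLine_mul_neg_qi (h : IsHyperhermitian g I J K) (w : E) (q : ℍ) :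
    quaternionLine I J K w (q * -qi) = I (quaternionLine I J K w q) := by
  rw [mul_neg_qi, quaternionLine_mk]
  simp only [quaternionLine_apply, map_sub, map_smul, h.sqI, h.IJ, h.IK]
  module

lemma quaternionLine_mul_neg_qj (h : IsHyperhermitian g I J K) (w : E) (q : ℍ) :
    quaternionLine I J K w (q * -qj) = J (quaternionLine I J K w q) := by
  rw [mul_neg_qj, quaternionLine_mk]
  simp only [quaternionLine_apply, map_sub, map_smul, h.sqJ, h.JI, h.JK]
  module

lemma quaternionLine_mul_neg_qk (h : IsHyperhermitian g I J K) (w : E) (q : ℍ) :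
    quaternionLine I J K w (q * -qk) = K (quaternionLine I J K w q) := by
  rw [mul_neg_qk, quaternionLine_mk]
  simp only [quaternionLine_apply, map_sub, map_smul, h.sqK, h.KI, h.KJ]
  module

/-- The vectors w, Iw, Jw, Kw are orthogonal of equal length, so the parametrization of the line is
conformal. -/
lemma inner_quaternionLine (h : IsHyperhermitian g I J K) (w : E) (q v : ℍ) :
    g (quaternionLine I J K w q) (quaternionLine I J K w v) =
      (q.re * v.re + q.imI * v.imI + q.imJ * v.imJ + q.imK * v.imK) * g w w := by
  have hI : g (I w) w = 0 := by
    have := h.skewI w w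
    rw [h.symm w] at this
    linarith
  have hJ : g (J w) w = 0 := by
    have := h.skewJ w w
    rw [h.symm w] at this
    linarith
  have hK : g (K w) w = 0 := by
    have := h.skewK w w
    rw [h.symm w] at this
    linarith
  have hIJ : g (I w) (J w) = 0 := by rw [h.skewI, h.IJ, h.symm, hK, neg_zero]
  have hIK : g (I w) (K w) = 0 := by rw [h.skewI, h.IK, map_neg, h.symm, hJ, neg_zero, neg_zero]
  have hJK : g (J w) (K w) = 0 := by rw [h.skewJ, h.JK, h.symm, hI, neg_zero]
  simp only [quaternionLine_apply, map_sub, map_smul, sub_apply, smul_apply, smul_eq_mul,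
    h.invI, h.invJ, h.invK, hI, hJ, hK, hIJ, hIK, hJK, h.symm w (I w), h.symm w (J w),
    h.symm w (K w), h.symm (J w) (I w), h.symm (K w) (I w), h.symm (K w) (J w)]
  ring

lemma quaternionLine_injective (h : IsHyperhermitian g I J K) {w : E} (hw : w ≠ 0) :
    Function.Injective (quaternionLine I J K w) := by
  rw [injective_iff_map_eq_zero]
  intro q hq
  have h1 := inner_quaternionLine h w q q
  rw [hq, map_zero] at h1
  have h2 : ‖q‖ ^ 2 = 0 := by
    rw [quaternion_norm_sq]
    refine (mul_eq_zero.1 (?_ : _ * g w w = 0)).resolve_right (h.pos w hw).ne'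
    linear_combination -h1
  simpa using h2

lemma rotate_exp_re (k : ℤ) (t : ℝ) (q : ℍ) : (rotate k (Circle.exp t) q).re =
    Real.cos (k * t) * q.re - Real.sin (k * t) * q.imI := by
  rw [rotate_eq_rotate_one, rotate_one_re, ← Circle.exp_zsmul, zsmul_eq_mul, Circle.coe_exp,
    Complex.exp_ofReal_mul_I_re, Complex.exp_ofReal_mul_I_im]

lemma rotate_exp_imI (k : ℤ) (t : ℝ) (q : ℍ) : (rotate k (Circle.exp t) q).imI =
    Real.cos (k * t) * q.imI + Real.sin (k * t) * q.re := by
  rw [rotate_eq_rotate_one, rotate_one_imI, ← Circle.exp_zsmul, zsmul_eq_mul, Circle.coe_exp,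
    Complex.exp_ofReal_mul_I_re, Complex.exp_ofReal_mul_I_im]

lemma rotate_exp_imJ (k : ℤ) (t : ℝ) (q : ℍ) : (rotate k (Circle.exp t) q).imJ =
    Real.cos (k * t) * q.imJ - Real.sin (k * t) * q.imK := by
  rw [rotate_eq_rotate_one, rotate_one_imJ, ← Circle.exp_zsmul, zsmul_eq_mul, Circle.coe_exp,
    Complex.exp_ofReal_mul_I_re, Complex.exp_ofReal_mul_I_im]

lemma rotate_exp_imK (k : ℤ) (t : ℝ) (q : ℍ) : (rotate k (Circle.exp t) q).imK =
    Real.cos (k * t) * q.imK + Real.sin (k * t) * q.imJ := by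
  rw [rotate_eq_rotate_one, rotate_one_imK, ← Circle.exp_zsmul, zsmul_eq_mul, Circle.coe_exp,
    Complex.exp_ofReal_mul_I_re, Complex.exp_ofReal_mul_I_im]

/-- ρ commutes with I, J, K, so on the line it is determined by its value at w. Right
multiplications carry the complex structures, which leaves left multiplication for the circle. -/
lemma IsCircleRep.map_quaternionLine (h : IsHyperhermitian g I J K) (hρ : IsCircleRep g I J K ρ)
    {k : ℤ} {w : E} (hw : ∀ t : ℝ, ρ t w = Real.cos (k * t) • w - Real.sin (k * t) • I w)
    (t : ℝ) (q : ℍ) :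
    ρ t (quaternionLine I J K w q) = quaternionLine I J K w (rotate k (Circle.exp t) q) := by
  simp only [quaternionLine_apply, map_sub, map_smul, hρ.commI, hρ.commJ, hρ.commK, hw,
    rotate_exp_re, rotate_exp_imI, rotate_exp_imJ, rotate_exp_imK, h.sqI, h.JI, h.KI]
  module

end LinearAlgebra

/-! ### Transport of hyperhermitian structures by linear isomorphisms -/

section Conjugation

variable {E : Type*} [NormedAddCommGroup E] [NormedSpace ℝ E]

/-- The endomorphism `L⁻¹ A L`. -/
def conjEnd (L : E ≃L[ℝ] E) (A : E →L[ℝ] E) : E →L[ℝ] E :=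
  (L.symm : E →L[ℝ] E).comp (A.comp (L : E →L[ℝ] E))

lemma apply_conjEnd (L : E ≃L[ℝ] E) (A : E →L[ℝ] E) (u : E) : L (conjEnd L A u) = A (L u) := by
  simp [conjEnd]

/-- The pullback of a bilinear form. -/
def pullForm (L : E ≃L[ℝ] E) (g : E →L[ℝ] E →L[ℝ] ℝ) : E →L[ℝ] E →L[ℝ] ℝ :=
  g.bilinearComp (L : E →L[ℝ] E) (L : E →L[ℝ] E)

lemma pullForm_apply (L : E ≃L[ℝ] E) (g : E →L[ℝ] E →L[ℝ] ℝ) (u v : E) :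
    pullForm L g u v = g (L u) (L v) := rfl

lemma IsHyperhermitian.pullback {g : E →L[ℝ] E →L[ℝ] ℝ} {I J K : E →L[ℝ] E}
    (h : IsHyperhermitian g I J K) (L : E ≃L[ℝ] E) :
    IsHyperhermitian (pullForm L g) (conjEnd L I) (conjEnd L J) (conjEnd L K) where
  symm u v := h.symm _ _
  pos u hu := h.pos _ fun h0 => hu (L.map_eq_zero_iff.1 h0)
  sqI u := L.injective (by rw [apply_conjEnd, apply_conjEnd, h.sqI, map_neg])
  sqJ u := L.injective (by rw [apply_conjEnd, apply_conjEnd, h.sqJ, map_neg])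
  sqK u := L.injective (by rw [apply_conjEnd, apply_conjEnd, h.sqK, map_neg])
  invI u v := by simp only [pullForm_apply, apply_conjEnd, h.invI]
  invJ u v := by simp only [pullForm_apply, apply_conjEnd, h.invJ]
  invK u v := by simp only [pullForm_apply, apply_conjEnd, h.invK]
  IJ u := L.injective (by simp only [apply_conjEnd, h.IJ])
  JI u := L.injective (by simp only [map_neg, apply_conjEnd, h.JI])

end Conjugation

/-! ### From tangent spaces to the model space -/

section Fibers

variable {E : Type*} [NormedAddCommGroup E] [NormedSpace ℝ E]
  {M : Type*} [TopologicalSpace M] [ChartedSpace E M]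

/-- The value of a vector field at a point, as an element of the model space. -/
def VField.at (X : VField E M) (x : M) : E := X x

/-- The value of a field of endomorphisms at a point, acting on the model space. -/
def EndField.at (A : EndField E M) (x : M) : E →L[ℝ] E := A x

/-- The derivative of the action, acting on the model space. -/
def actionAt [SMul Circle M] (z : Circle) (x : M) : E →L[ℝ] E := actionDeriv (E := E) z x

/-- The derivative of a parametrization `f` at `v`, with values in the model space. -/
def paramDeriv {F : Type*} [NormedAddCommGroup F] [NormedSpace ℝ F] (f : F → M) (v : F) :
    F →L[ℝ] E :=
  mfderiv 𝓘(ℝ, F) 𝓘(ℝ, E) f v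

variable [IsManifold 𝓘(ℝ, E) ∞ M]

/-- The value of the metric at a point, as a bilinear form on the model space. -/
def metricAt (g : RMetric E M) (x : M) : E →L[ℝ] E →L[ℝ] ℝ := g.inner x

lemma isHyperhermitian_at (H : HyperkahlerStructure E M) (x : M) :
    IsHyperhermitian (metricAt H.g x) (H.I.at x) (H.J.at x) (H.K.at x) where
  symm := H.g.symm x
  pos := H.g.pos x
  sqI := H.kahler_I.complex.sq x
  sqJ := H.kahler_J.complex.sq x
  sqK := H.kahler_K.complex.sq x
  invI := H.kahler_I.hermitian x
  invJ := H.kahler_J.hermitian x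
  invK := H.kahler_K.hermitian x
  IJ := H.mul_IJ x
  JI := H.mul_JI x

variable [MulAction Circle M] [ContMDiffSMul (𝓡 1) 𝓘(ℝ, E) ∞ Circle M]

lemma hasMFDerivAt_smul (z : Circle) (x : M) :
    HasMFDerivAt 𝓘(ℝ, E) 𝓘(ℝ, E) (fun y : M => z • y) x (actionAt (E := E) z x) :=
  (((contMDiff_smul (I := 𝓡 1) (I' := 𝓘(ℝ, E)) (n := ∞) (G := Circle) (M := M)).comp
    (contMDiff_const.prodMk contMDiff_id : ContMDiff 𝓘(ℝ, E) ((𝓡 1).prod 𝓘(ℝ, E)) ∞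
      fun y : M => (z, y))).mdifferentiableAt (by simp)).hasMFDerivAt

namespace IsLinearization

variable {p : M} {e : OpenPartialHomeomorph E M} {ρ : ℝ → E →L[ℝ] E}

lemma mdifferentiable (h : IsLinearization p e ρ) : e.MDifferentiable 𝓘(ℝ, E) 𝓘(ℝ, E) :=
  ⟨h.smooth.mdifferentiableOn (by simp), h.smooth_symm.mdifferentiableOn (by simp)⟩

lemma hasMFDerivAt (h : IsLinearization p e ρ) {v : E} (hv : v ∈ e.source) :
    HasMFDerivAt 𝓘(ℝ, E) 𝓘(ℝ, E) e v (paramDeriv e v : E →L[ℝ] E) :=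
  (h.mdifferentiable.mdifferentiableAt hv).hasMFDerivAt

/-- The derivative of the parametrization at the origin. -/
def derivZero (h : IsLinearization p e ρ) : E ≃L[ℝ] E :=
  h.mdifferentiable.mfderiv h.zero_mem

lemma paramDeriv_injective (h : IsLinearization p e ρ) {v : E} (hv : v ∈ e.source) :
    Function.Injective (paramDeriv e v : E →L[ℝ] E) :=
  h.mdifferentiable.mfderiv_injective hv

lemma smul_zero (h : IsLinearization p e ρ) (t : ℝ) : Circle.exp t • e 0 = e 0 := by
  rw [← h.equivariant 0 h.zero_mem t, _root_.map_zero]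

/-- Differentiating the equivariance of e at 0 identifies ρ with the isotropy representation on the
tangent space at p. -/
lemma actionAt_derivZero (h : IsLinearization p e ρ) (t : ℝ) (u : E) :
    actionAt (Circle.exp t) (e 0) (h.derivZero u) = h.derivZero (ρ t u) := by
  have h1 := HasMFDerivAt.comp (0 : E) (hasMFDerivAt_smul (E := E) (Circle.exp t) (e 0))
    (h.hasMFDerivAt h.zero_mem)
  have h2 : HasMFDerivAt 𝓘(ℝ, E) 𝓘(ℝ, E) e (ρ t 0) (paramDeriv e 0 : E →L[ℝ] E) := by
    rw [_root_.map_zero]; exact h.hasMFDerivAt h.zero_mem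
  have h3 := HasMFDerivAt.comp (0 : E) h2 (ρ t).hasMFDerivAt
  have h4 : (fun y : M => Circle.exp t • y) ∘ e =ᶠ[𝓝 0] e ∘ ρ t := by
    filter_upwards [e.open_source.mem_nhds h.zero_mem] with v hv
    exact (h.equivariant v hv t).symm
  have h5 := hasMFDerivAt_unique h1 (h3.congr_of_eventuallyEq h4)
  exact congrArg (fun L : E →L[ℝ] E => L u) h5

lemma comm_conjEnd (h : IsLinearization p e ρ) {A : EndField E M} (hA : Preserves A) (t : ℝ)
    (u : E) : ρ t (conjEnd h.derivZero (A.at (e 0)) u) =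
      conjEnd h.derivZero (A.at (e 0)) (ρ t u) := by
  apply h.derivZero.injective
  have h2 : ∀ w : E, actionAt (Circle.exp t) (e 0) (A.at (e 0) w) =
      A.at (Circle.exp t • e 0) (actionAt (Circle.exp t) (e 0) w) := fun w => hA _ _ w
  rw [← h.actionAt_derivZero, apply_conjEnd, h2, h.smul_zero, apply_conjEnd, h.actionAt_derivZero]

lemma isCircleRep (h : IsLinearization p e ρ) {H : HyperkahlerStructure E M} {X : VField E M}
    {μ : M → EuclideanSpace ℝ (Fin 3)} (hμ : IsTriHamiltonian H X μ) :
    IsCircleRep (pullForm h.derivZero (metricAt H.g (e 0)))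
      (conjEnd h.derivZero (H.I.at (e 0))) (conjEnd h.derivZero (H.J.at (e 0)))
      (conjEnd h.derivZero (H.K.at (e 0))) ρ where
  contDiff := h.contDiff
  zero := h.zero
  add := h.add
  periodic := h.periodic
  isometric t u v := by
    have h1 : ∀ u v : E, metricAt H.g (Circle.exp t • e 0) (actionAt (Circle.exp t) (e 0) u)
      (actionAt (Circle.exp t) (e 0) v) = metricAt H.g (e 0) u v :=
        hμ.isometric (Circle.exp t) (e 0)
    have h2 := h1 (h.derivZero u) (h.derivZero v)
    rwa [h.smul_zero, h.actionAt_derivZero, h.actionAt_derivZero] at h2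
  commI := h.comm_conjEnd hμ.preserves_I
  commJ := h.comm_conjEnd hμ.preserves_J
  commK := h.comm_conjEnd hμ.preserves_K

/-- The generating vector field in the linearizing parametrization. -/
lemma generator_eq (h : IsLinearization p e ρ) {X : VField E M} (hX : Generates X) {v : E}
    (hv : v ∈ e.source) : X.at (e v) = (paramDeriv e v : E →L[ℝ] E) (deriv ρ 0 v) := by
  have h1 := hX (e v) 0
  have h2 : HasFDerivAt (fun t => ρ t v) ((1 : ℝ →L[ℝ] ℝ).smulRight (deriv ρ 0 v)) 0 := by
    have h3 : HasDerivAt (fun t => ρ t v) (deriv ρ 0 v) 0 :=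
      ((ContinuousLinearMap.apply ℝ E v).hasFDerivAt).comp_hasDerivAt (0 : ℝ)
        ((h.contDiff.differentiable (by simp)) 0).hasDerivAt
    exact h3.hasFDerivAt
  have h0 : ρ 0 v = v := by rw [h.zero]; rfl
  have h4 : HasMFDerivAt 𝓘(ℝ, E) 𝓘(ℝ, E) e (ρ 0 v) (paramDeriv e v : E →L[ℝ] E) := by
    rw [h0]; exact h.hasMFDerivAt hv
  have h5 := HasMFDerivAt.comp (0 : ℝ) h4 h2.hasMFDerivAt
  have h6 : (fun t : ℝ => Circle.exp t • e v) = e ∘ fun t => ρ t v :=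
    funext fun t => (h.equivariant v hv t).symm
  rw [← h6] at h5
  have h7 : (1 : ℝ →L[ℝ] ℝ) 1 • X.at (Circle.exp 0 • e v) =
      (paramDeriv e v : E →L[ℝ] E) ((1 : ℝ →L[ℝ] ℝ) 1 • deriv ρ 0 v) :=
    congrArg (fun L : ℝ →L[ℝ] E => L 1) (hasMFDerivAt_unique h1 h5)
  simpa using h7

end IsLinearization

end Fibers

/-! ### The Kähler forms and the moment map in coordinates -/

section Moment

variable {E : Type*} [NormedAddCommGroup E] [NormedSpace ℝ E]
  {M : Type*} [TopologicalSpace M] [ChartedSpace E M] [IsManifold 𝓘(ℝ, E) ∞ M]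

/-- The two-form `g(A ·, ·)` pulled back by the parametrization `e`. -/
def pullTwoForm (g : RMetric E M) (A : EndField E M) (e : E → M) (v : E) : E →L[ℝ] E →L[ℝ] ℝ :=
  (metricAt g (e v)).bilinearComp ((A.at (e v)).comp (paramDeriv e v)) (paramDeriv e v)

lemma pullTwoForm_apply (g : RMetric E M) (A : EndField E M) (e : E → M) (v u w : E) :
    pullTwoForm g A e v u w = metricAt g (e v) (A.at (e v) ((paramDeriv e v : E →L[ℝ] E) u))
      ((paramDeriv e v : E →L[ℝ] E) w) := rfl

lemma contMDiffOn_paramDeriv {e : E → M} {s : Set E} (hs : IsOpen s)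
    (he : ContMDiffOn 𝓘(ℝ, E) 𝓘(ℝ, E) ∞ e s) (u : E) :
    ContMDiffOn 𝓘(ℝ, E) (𝓘(ℝ, E).prod 𝓘(ℝ, E)) ∞
      (fun v => (Bundle.TotalSpace.mk' E (e v) (mfderiv 𝓘(ℝ, E) 𝓘(ℝ, E) e v u) :
        TangentBundle 𝓘(ℝ, E) M)) s := by
  have h1 := he.contMDiffOn_tangentMapWithin (m := ∞) (by simp) hs.uniqueMDiffOn
  have h2 : ContMDiffOn 𝓘(ℝ, E) (𝓘(ℝ, E).prod 𝓘(ℝ, E)) ∞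
      (fun v => (Bundle.TotalSpace.mk' E v u : TangentBundle 𝓘(ℝ, E) E)) s :=
    contMDiffOn_vectorSpace_iff_contDiffOn.2 contDiffOn_const
  refine (h1.comp h2 fun v hv => hv).congr fun v hv => ?_
  simp only [Function.comp_apply, tangentMapWithin, mfderivWithin_of_isOpen hs hv]

/-- In finite dimension it suffices to test on constant vectors u and w, where the form is assembled
from smooth bundle sections. -/
lemma continuousOn_pullTwoForm [FiniteDimensional ℝ E] (g : RMetric E M) {A : EndField E M}
    (hA : A.IsSmooth) {e : E → M} {s : Set E} (hs : IsOpen s)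
    (he : ContMDiffOn 𝓘(ℝ, E) 𝓘(ℝ, E) ∞ e s) : ContinuousOn (pullTwoForm g A e) s := by
  rw [continuousOn_clm_apply]
  intro u
  rw [continuousOn_clm_apply]
  intro w v hv
  have hev := he.contMDiffAt (hs.mem_nhds hv)
  have hu := (contMDiffOn_paramDeriv hs he u).contMDiffAt (hs.mem_nhds hv)
  have hw := (contMDiffOn_paramDeriv hs he w).contMDiffAt (hs.mem_nhds hv)
  have hAe := ContMDiffAt.comp v (hA (e v)) hev
  have hge := ContMDiffAt.comp v (g.contMDiff (e v)) hev
  have hAu := ContMDiffAt.clm_bundle_apply hAe hu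
  have key : ContMDiffAt 𝓘(ℝ, E) (𝓘(ℝ, E).prod 𝓘(ℝ)) ∞
      (fun v => Bundle.TotalSpace.mk' ℝ (E := Bundle.Trivial M ℝ) (e v)
        (pullTwoForm g A e v u w)) v := by
    apply ContMDiffAt.clm_bundle_apply₂ (F₁ := E) (F₂ := E)
    · exact hge
    · exact hAu
    · exact hw
  rw [Bundle.contMDiffAt_totalSpace] at key
  exact key.2.continuousAt.continuousWithinAt

lemma moment_coord {H : HyperkahlerStructure E M} {A : EndField E M} {X : VField E M} {m : M → ℝ}
    (hm : ContMDiff 𝓘(ℝ, E) 𝓘(ℝ, ℝ) ∞ m)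
    (hA : ∀ (x : M) (v : TangentSpace 𝓘(ℝ, E) x),
      mfderiv 𝓘(ℝ, E) 𝓘(ℝ, ℝ) m x v = fundamentalForm H.g A x (X x) v)
    {e : E → M} {v : E} (he : HasMFDerivAt 𝓘(ℝ, E) 𝓘(ℝ, E) e v (paramDeriv e v : E →L[ℝ] E)) :
    HasFDerivAt (fun v => m (e v))
      ((metricAt H.g (e v) (A.at (e v) (X.at (e v)))).comp (paramDeriv e v : E →L[ℝ] E)) v := by
  have h1 := HasMFDerivAt.comp v ((hm.mdifferentiableAt (x := e v) (by simp)).hasMFDerivAt) he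
  have h2 := h1.hasFDerivAt
  have h3 : (mfderiv 𝓘(ℝ, E) 𝓘(ℝ, ℝ) m (e v) : E →L[ℝ] ℝ) =
      metricAt H.g (e v) (A.at (e v) (X.at (e v))) := ContinuousLinearMap.ext fun u => hA (e v) u
  rw [← h3]
  exact h2

lemma contMDiff_coord {μ : M → EuclideanSpace ℝ (Fin 3)}
    (hμ : ContMDiff 𝓘(ℝ, E) 𝓘(ℝ, EuclideanSpace ℝ (Fin 3)) ∞ μ) (i : Fin 3) :
    ContMDiff 𝓘(ℝ, E) 𝓘(ℝ, ℝ) ∞ fun x => μ x i :=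
  (EuclideanSpace.proj i : EuclideanSpace ℝ (Fin 3) →L[ℝ] ℝ).contMDiff.comp hμ

end Moment

/-! ### The moment map along a quaternionic line -/

lemma qi_mul (q : ℍ) : qi * q = (⟨-q.imI, q.re, -q.imK, q.imJ⟩ : ℍ) := by
  ext <;> simp <;> simp [qi]

lemma qi_mul_re (q : ℍ) : (qi * q).re = -q.imI := congrArg (fun x : ℍ => x.re) (qi_mul q)

lemma qi_mul_imI (q : ℍ) : (qi * q).imI = q.re := congrArg (fun x : ℍ => x.imI) (qi_mul q)

lemma qi_mul_imJ (q : ℍ) : (qi * q).imJ = -q.imK := congrArg (fun x : ℍ => x.imJ) (qi_mul q)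

lemma qi_mul_imK (q : ℍ) : (qi * q).imK = q.imJ := congrArg (fun x : ℍ => x.imK) (qi_mul q)

lemma norm_qi_mul (q : ℍ) : ‖qi * q‖ = ‖q‖ := by
  rw [← sq_eq_sq₀ (norm_nonneg _) (norm_nonneg _), quaternion_norm_sq, quaternion_norm_sq,
    qi_mul_re, qi_mul_imI, qi_mul_imJ, qi_mul_imK]
  ring

section Representation

variable {E : Type*} [NormedAddCommGroup E] [NormedSpace ℝ E]
  {g : E →L[ℝ] E →L[ℝ] ℝ} {I J K : E →L[ℝ] E} {ρ : ℝ → E →L[ℝ] E}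

/-- Infinitesimal form of the weight k rotation: the generator is left multiplication by ki. -/
lemma IsCircleRep.deriv_quaternionLine (h : IsHyperhermitian g I J K)
    (hρ : IsCircleRep g I J K ρ) {k : ℤ} {w : E}
    (hw : ∀ t : ℝ, ρ t w = Real.cos (k * t) • w - Real.sin (k * t) • I w) (q : ℍ) :
    deriv ρ 0 (quaternionLine I J K w q) = quaternionLine I J K w ((k : ℝ) • (qi * q)) := by
  have h1 := hρ.hasDerivAt_apply_zero (quaternionLine I J K w q)
  have hlin : HasDerivAt (fun t : ℝ => (k : ℝ) * t) k 0 := by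
    simpa using (hasDerivAt_id (0 : ℝ)).const_mul (k : ℝ)
  have h2 := (hlin.cos.smul_const (quaternionLine I J K w q)).add
    (hlin.sin.smul_const (quaternionLine I J K w (qi * q)))
  have e : (fun t => ρ t (quaternionLine I J K w q)) =
      (fun t : ℝ => Real.cos (k * t) • quaternionLine I J K w q) +
        fun t : ℝ => Real.sin (k * t) • quaternionLine I J K w (qi * q) := by
    funext t
    rw [hρ.map_quaternionLine h hw, Pi.add_apply, ← map_smul, ← map_smul, ← map_add]
    congr 1
    ext
    · rw [rotate_exp_re]; simp [qi_mul_re, -Quaternion.re_mul]; ring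
    · rw [rotate_exp_imI]; simp [qi_mul_imI, -Quaternion.imI_mul]
    · rw [rotate_exp_imJ]; simp [qi_mul_imJ, -Quaternion.imJ_mul]; ring
    · rw [rotate_exp_imK]; simp [qi_mul_imK, -Quaternion.imK_mul]
  rw [e] at h1
  rw [h1.unique h2]
  simp

/-- This and its two analogues for J and K compute dμ for the flat model: contracting the generator
with the three constant forms gives the polarization of q̄ i q. -/
lemma I_quaternionLine_qi_mul (h : IsHyperhermitian g I J K) (w : E) (r : ℝ) (q v : ℍ) :
    g (I (quaternionLine I J K w (r • (qi * q)))) (quaternionLine I J K w v) =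
      r * g w w * hopfPolar q v 0 := by
  rw [← quaternionLine_mul_neg_qi h, inner_quaternionLine h, mul_neg_qi]
  simp only [Quaternion.re_smul, Quaternion.imI_smul, Quaternion.imJ_smul, Quaternion.imK_smul,
    qi_mul_re, qi_mul_imI, qi_mul_imJ, qi_mul_imK, smul_eq_mul]
  simp [hopfPolar]
  ring

lemma J_quaternionLine_qi_mul (h : IsHyperhermitian g I J K) (w : E) (r : ℝ) (q v : ℍ) :
    g (J (quaternionLine I J K w (r • (qi * q)))) (quaternionLine I J K w v) =
      r * g w w * hopfPolar q v 1 := by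
  rw [← quaternionLine_mul_neg_qj h, inner_quaternionLine h, mul_neg_qj]
  simp only [Quaternion.re_smul, Quaternion.imI_smul, Quaternion.imJ_smul, Quaternion.imK_smul,
    qi_mul_re, qi_mul_imI, qi_mul_imJ, qi_mul_imK, smul_eq_mul]
  simp [hopfPolar]
  ring

lemma K_quaternionLine_qi_mul (h : IsHyperhermitian g I J K) (w : E) (r : ℝ) (q v : ℍ) :
    g (K (quaternionLine I J K w (r • (qi * q)))) (quaternionLine I J K w v) =
      r * g w w * hopfPolar q v 2 := by
  rw [← quaternionLine_mul_neg_qk h, inner_quaternionLine h, mul_neg_qk]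
  simp only [Quaternion.re_smul, Quaternion.imI_smul, Quaternion.imJ_smul, Quaternion.imK_smul,
    qi_mul_re, qi_mul_imI, qi_mul_imJ, qi_mul_imK, smul_eq_mul]
  simp [hopfPolar]
  ring

end Representation

section Slice

variable {E : Type*} [NormedAddCommGroup E] [NormedSpace ℝ E] [FiniteDimensional ℝ E]
  {M : Type*} [TopologicalSpace M] [ChartedSpace E M] [IsManifold 𝓘(ℝ, E) ∞ M]
  [MulAction Circle M] [ContMDiffSMul (𝓡 1) 𝓘(ℝ, E) ∞ Circle M]
  {p : M} {e : OpenPartialHomeomorph E M} {ρ : ℝ → E →L[ℝ] E}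

namespace IsLinearization

/-- The derivative of a moment map component along a quaternion line of weight `k`, to first
order at the fixed point. -/
lemma moment_close (h : IsLinearization p e ρ) {H : HyperkahlerStructure E M} {A : EndField E M}
    (hAs : A.IsSmooth) {X : VField E M} (hX : Generates X) {m : M → ℝ}
    (hm : ContMDiff 𝓘(ℝ, E) 𝓘(ℝ, ℝ) ∞ m)
    (hA : ∀ (x : M) (v : TangentSpace 𝓘(ℝ, E) x),
      mfderiv 𝓘(ℝ, E) 𝓘(ℝ, ℝ) m x v = fundamentalForm H.g A x (X x) v)
    {l : ℍ →L[ℝ] E} {r : ℝ} (hl : ∀ q, deriv ρ 0 (l q) = l (r • (qi * q))) {ε : ℝ} (hε : 0 < ε) :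
    ∀ᶠ q in 𝓝 (0 : ℍ), DifferentiableAt ℝ (fun x => m (e (l x))) q ∧
      ∀ v, |fderiv ℝ (fun x => m (e (l x))) q v -
        pullForm h.derivZero (metricAt H.g (e 0))
          (conjEnd h.derivZero (A.at (e 0)) (l (r • (qi * q)))) (l v)| ≤ ε * ‖q‖ * ‖v‖ := by
  have h0 : ∀ u v, pullForm h.derivZero (metricAt H.g (e 0))
      (conjEnd h.derivZero (A.at (e 0)) u) v = pullTwoForm H.g A e 0 u v := by
    intro u v
    rw [pullForm_apply, apply_conjEnd]
    rfl
  have hcont : ContinuousAt (fun q : ℍ => pullTwoForm H.g A e (l q)) 0 := by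
    have h1 : ContinuousAt (pullTwoForm H.g A e) (l 0) := by
      rw [_root_.map_zero]
      exact (continuousOn_pullTwoForm H.g hAs e.open_source h.smooth).continuousAt
        (e.open_source.mem_nhds h.zero_mem)
    exact ContinuousAt.comp (f := l) h1 l.continuous.continuousAt
  -- The summand 1 keeps C positive even when r or l vanishes.
  set C := ‖l‖ * |r| * ‖l‖ + 1 with hC
  have hCpos : 0 < C := by positivity
  have hsrc : ∀ᶠ q in 𝓝 (0 : ℍ), l q ∈ e.source :=
    l.continuous.continuousAt.preimage_mem_nhds
      (e.open_source.mem_nhds (by rw [_root_.map_zero]; exact h.zero_mem))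
  filter_upwards [hsrc, (Metric.continuousAt_iff'
    (f := fun q : ℍ => pullTwoForm H.g A e (l q))).1 hcont (ε / C) (by positivity)] with q hq hd
  have hder := (moment_coord hm hA (h.hasMFDerivAt hq)).comp q l.hasFDerivAt
  refine ⟨hder.differentiableAt, fun v => ?_⟩
  -- The generator is exactly linear in these coordinates, so replacing the form at l q by its value
  -- at 0 is the only error. A small change of the form costs a small multiple of ‖q‖.
  have e1 : fderiv ℝ (fun x => m (e (l x))) q v =
      pullTwoForm H.g A e (l q) (l (r • (qi * q))) (l v) := by
    have h2 : fderiv ℝ (fun x => m (e (l x))) q = _ := hder.fderiv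
    rw [h2, ← hl, pullTwoForm_apply, ← h.generator_eq hX hq]
    rfl
  rw [_root_.map_zero] at hd
  have hd' : ‖pullTwoForm H.g A e (l q) - pullTwoForm H.g A e 0‖ < ε / C :=
    (dist_eq_norm (pullTwoForm H.g A e (l q)) (pullTwoForm H.g A e 0)).symm.trans_lt hd
  rw [e1, h0]
  have h3 : ‖l (r • (qi * q))‖ ≤ ‖l‖ * (|r| * ‖q‖) := by
    refine (l.le_opNorm _).trans ?_
    rw [norm_smul, norm_qi_mul, Real.norm_eq_abs]
  have h4 : ‖l v‖ ≤ ‖l‖ * ‖v‖ := l.le_opNorm _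
  calc _ ≤ ‖pullTwoForm H.g A e (l q) - pullTwoForm H.g A e 0‖ * ‖l (r • (qi * q))‖ * ‖l v‖ :=
        ContinuousLinearMap.le_opNorm₂ (pullTwoForm H.g A e (l q) - pullTwoForm H.g A e 0) _ _
    _ ≤ ε / C * (‖l‖ * (|r| * ‖q‖)) * (‖l‖ * ‖v‖) := by gcongr
    _ = ε / C * (‖l‖ * |r| * ‖l‖) * ‖q‖ * ‖v‖ := by ring
    _ ≤ ε / C * C * ‖q‖ * ‖v‖ := by
      gcongr
      rw [hC]; linarith
    _ = ε * ‖q‖ * ‖v‖ := by rw [div_mul_cancel₀ _ hCpos.ne']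

lemma isHopfLike (h : IsLinearization p e ρ) {H : HyperkahlerStructure E M} {X : VField E M}
    {μ : M → EuclideanSpace ℝ (Fin 3)} (hμ : IsTriHamiltonian H X μ) {k : ℤ} {w : E}
    (hw : ∀ t : ℝ, ρ t w = Real.cos (k * t) • w -
      Real.sin (k * t) • conjEnd h.derivZero (H.I.at (e 0)) w) :
    IsHopfLike (fun q => μ (e (quaternionLine (conjEnd h.derivZero (H.I.at (e 0)))
        (conjEnd h.derivZero (H.J.at (e 0))) (conjEnd h.derivZero (H.K.at (e 0))) w q)))
      (k * pullForm h.derivZero (metricAt H.g (e 0)) w w / 2) := by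
  have hH := (isHyperhermitian_at H (e 0)).pullback h.derivZero
  have hl := (h.isCircleRep hμ).deriv_quaternionLine hH hw
  have hI := fun (ε : ℝ) (hε : 0 < ε) => h.moment_close H.kahler_I.complex.smooth hμ.generates
    (contMDiff_coord hμ.smooth 0) hμ.moment_I hl hε
  have hJ := fun (ε : ℝ) (hε : 0 < ε) => h.moment_close H.kahler_J.complex.smooth hμ.generates
    (contMDiff_coord hμ.smooth 1) hμ.moment_J hl hε
  have hK := fun (ε : ℝ) (hε : 0 < ε) => h.moment_close H.kahler_K.complex.smooth hμ.generates
    (contMDiff_coord hμ.smooth 2) hμ.moment_K hl hε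
  refine ⟨?_, fun ε hε => ?_⟩
  · filter_upwards [hI 1 one_pos, hJ 1 one_pos, hK 1 one_pos] with q h1 h2 h3 i
    fin_cases i
    exacts [h1.1, h2.1, h3.1]
  · filter_upwards [hI ε hε, hJ ε hε, hK ε hε] with q h1 h2 h3 i v
    -- The 2 in the denominator of c cancels the 2 from differentiating a quadratic map.
    rw [mul_div_cancel₀ _ two_ne_zero]
    fin_cases i
    · have := h1.2 v
      rwa [I_quaternionLine_qi_mul hH] at this
    · have := h2.2 v
      rwa [J_quaternionLine_qi_mul hH] at this
    · have := h3.2 v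
      rwa [K_quaternionLine_qi_mul hH] at this

end IsLinearization

end Slice

/-! ### Invariance of the moment map and openness off the fixed points -/

/-- Iw, Jw, Kw are orthogonal with square length g(w,w), so (y₀ Iw + y₁ Jw + y₂ Kw)/g(w,w) works;
the signs in the proof come from the convention for `quaternionLine`. -/
lemma IsHyperhermitian.exists_moment_preimage {E : Type*} [NormedAddCommGroup E] [NormedSpace ℝ E]
    {g : E →L[ℝ] E →L[ℝ] ℝ} {I J K : E →L[ℝ] E} (h : IsHyperhermitian g I J K) {w : E}
    (hw : w ≠ 0) (y : EuclideanSpace ℝ (Fin 3)) :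
    ∃ v, g (I w) v = y 0 ∧ g (J w) v = y 1 ∧ g (K w) v = y 2 := by
  have hn := (h.pos w hw).ne'
  have hI : I w = quaternionLine I J K w (⟨0, -1, 0, 0⟩ : ℍ) := by rw [quaternionLine_mk]; module
  have hJ : J w = quaternionLine I J K w (⟨0, 0, -1, 0⟩ : ℍ) := by rw [quaternionLine_mk]; module
  have hK : K w = quaternionLine I J K w (⟨0, 0, 0, -1⟩ : ℍ) := by rw [quaternionLine_mk]; module
  refine ⟨quaternionLine I J K w
    (⟨0, -(y 0 / g w w), -(y 1 / g w w), -(y 2 / g w w)⟩ : ℍ), ?_, ?_, ?_⟩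
  · refine (congrArg (fun u => g u _) hI).trans ((inner_quaternionLine h w _ _).trans ?_)
    simp [hn]
  · refine (congrArg (fun u => g u _) hJ).trans ((inner_quaternionLine h w _ _).trans ?_)
    simp [hn]
  · refine (congrArg (fun u => g u _) hK).trans ((inner_quaternionLine h w _ _).trans ?_)
    simp [hn]

section

variable {E : Type*} [NormedAddCommGroup E] [NormedSpace ℝ E]
  {M : Type*} [TopologicalSpace M] [ChartedSpace E M] [IsManifold 𝓘(ℝ, E) ∞ M]

/-- A curve with vanishing derivative is constant. -/
lemma eq_of_hasMFDerivAt_zero {γ : ℝ → M}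
    (hγ : ∀ t, HasMFDerivAt 𝓘(ℝ, ℝ) 𝓘(ℝ, E) γ t (0 : ℝ →L[ℝ] E)) (s t : ℝ) : γ s = γ t := by
  have hl : IsLocallyConstant γ := by
    rw [IsLocallyConstant.iff_eventually_eq]
    intro t₀
    set χ := chartAt E (γ t₀)
    have hcont : Continuous γ := continuous_iff_continuousAt.2 fun t => (hγ t).continuousAt
    have hd : ∀ t, γ t ∈ χ.source → HasFDerivAt (χ ∘ γ) (0 : ℝ →L[ℝ] E) t := by
      intro t ht
      have h1 := ((contMDiffOn_chart (I := 𝓘(ℝ, E)) (n := ∞) (x := γ t₀)).contMDiffAt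
        (χ.open_source.mem_nhds ht)).mdifferentiableAt (by simp)
      have h2 := HasMFDerivAt.comp t h1.hasMFDerivAt (hγ t)
      have h3 := h2.hasFDerivAt
      have h4 : ((mfderiv 𝓘(ℝ, E) 𝓘(ℝ, E) χ (γ t) : E →L[ℝ] E).comp (0 : ℝ →L[ℝ] E)) = 0 :=
        ContinuousLinearMap.comp_zero _
      exact h4 ▸ h3
    obtain ⟨ε, hε, hball⟩ := Metric.mem_nhds_iff.1 (hcont.continuousAt.preimage_mem_nhds
      (χ.open_source.mem_nhds (mem_chart_source E (γ t₀))))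
    filter_upwards [Metric.ball_mem_nhds t₀ hε] with t ht
    have h5 := Metric.isOpen_ball.is_const_of_fderiv_eq_zero (𝕜 := ℝ) (f := χ ∘ γ)
      (convex_ball t₀ ε).isPreconnected
      (fun t ht => (hd t (hball ht)).differentiableAt.differentiableWithinAt)
      (fun t ht => (hd t (hball ht)).fderiv) ht (Metric.mem_ball_self hε)
    exact χ.injOn (hball ht) (mem_chart_source E (γ t₀)) h5
  exact hl.apply_eq_of_isPreconnected isPreconnected_univ trivial trivial

variable [MulAction Circle M] [ContMDiffSMul (𝓡 1) 𝓘(ℝ, E) ∞ Circle M]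

/-- The action pushes X at x forward to X along the orbit of x, so X vanishes on the whole orbit and
the orbit curve is constant. Uniqueness for differential equations is not needed. -/
lemma fixed_of_generator_eq_zero {X : VField E M} (hX : Generates X) {x : M} (hx : X.at x = 0)
    (z : Circle) : z • x = x := by
  obtain ⟨t, rfl⟩ := Circle.exp_surjective z
  have h0 : ∀ t : ℝ, HasMFDerivAt 𝓘(ℝ, ℝ) 𝓘(ℝ, E) (fun t : ℝ => Circle.exp t • x) t
      (0 : ℝ →L[ℝ] E) := by
    intro t
    have h1 : HasMFDerivAt 𝓘(ℝ, ℝ) 𝓘(ℝ, E) ((fun t : ℝ => Circle.exp t • x) ∘ (· + t)) 0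
        ((1 : ℝ →L[ℝ] ℝ).smulRight (X.at (Circle.exp (0 + t) • x)) : ℝ →L[ℝ] E) :=
      (hX x).comp_add t 0
    have hXx : HasMFDerivAt 𝓘(ℝ, ℝ) 𝓘(ℝ, E) (fun t : ℝ => Circle.exp t • x) 0
        ((1 : ℝ →L[ℝ] ℝ).smulRight (X.at (Circle.exp 0 • x)) : ℝ →L[ℝ] E) := hX x 0
    have h2 := HasMFDerivAt.comp (0 : ℝ) (hasMFDerivAt_smul (E := E) (Circle.exp t)
      (Circle.exp 0 • x)) hXx
    have e : ((fun t : ℝ => Circle.exp t • x) ∘ (· + t)) =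
        (fun y : M => Circle.exp t • y) ∘ fun t : ℝ => Circle.exp t • x := by
      funext s
      simp only [Function.comp_apply, smul_smul, ← Circle.exp_add, add_comm]
    rw [e] at h1
    have h3 : (1 : ℝ →L[ℝ] ℝ) 1 • X.at (Circle.exp (0 + t) • x) =
        actionAt (Circle.exp t) (Circle.exp 0 • x)
          ((1 : ℝ →L[ℝ] ℝ) 1 • X.at (Circle.exp 0 • x)) :=
      congrArg (fun L : ℝ →L[ℝ] E => L 1) (hasMFDerivAt_unique h1 h2)
    rw [Circle.exp_zero, one_smul, hx, smul_zero, map_zero, zero_add] at h3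
    have h4 : X.at (Circle.exp t • x) = 0 := by simpa using h3
    have h5 : HasMFDerivAt 𝓘(ℝ, ℝ) 𝓘(ℝ, E) (fun t : ℝ => Circle.exp t • x) t
        ((1 : ℝ →L[ℝ] ℝ).smulRight (X.at (Circle.exp t • x)) : ℝ →L[ℝ] E) := hX x t
    have h6 : ((1 : ℝ →L[ℝ] ℝ).smulRight (X.at (Circle.exp t • x)) : ℝ →L[ℝ] E) = 0 := by
      rw [h4]; ext; simp
    exact h6 ▸ h5
  simpa using eq_of_hasMFDerivAt_zero h0 t 0

/-- Along an orbit the derivative of m is g(AX, X), which vanishes because A is skew. -/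
lemma moment_invariant {H : HyperkahlerStructure E M} {A : EndField E M} {X : VField E M}
    (hX : Generates X) {m : M → ℝ} (hm : ContMDiff 𝓘(ℝ, E) 𝓘(ℝ, ℝ) ∞ m)
    (hA : ∀ (x : M) (v : TangentSpace 𝓘(ℝ, E) x),
      mfderiv 𝓘(ℝ, E) 𝓘(ℝ, ℝ) m x v = fundamentalForm H.g A x (X x) v)
    (hskew : ∀ (x : M) (v : E), metricAt H.g x (A.at x v) v = 0) (z : Circle) (x : M) :
    m (z • x) = m x := by
  obtain ⟨t, rfl⟩ := Circle.exp_surjective z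
  have hd : ∀ t : ℝ, HasDerivAt (fun t : ℝ => m (Circle.exp t • x)) 0 t := by
    intro t
    have h1 := HasMFDerivAt.comp t
      ((hm.mdifferentiableAt (x := Circle.exp t • x) (by simp)).hasMFDerivAt) (hX x t)
    have h3 : (mfderiv 𝓘(ℝ, E) 𝓘(ℝ, ℝ) m (Circle.exp t • x) : E →L[ℝ] ℝ) =
      metricAt H.g (Circle.exp t • x) (A.at (Circle.exp t • x) (X.at (Circle.exp t • x))) :=
      ContinuousLinearMap.ext fun v => hA _ v
    have h2 : HasFDerivAt (fun t : ℝ => m (Circle.exp t • x))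
        ((metricAt H.g (Circle.exp t • x) (A.at (Circle.exp t • x)
          (X.at (Circle.exp t • x)))).comp
          ((1 : ℝ →L[ℝ] ℝ).smulRight (X.at (Circle.exp t • x)))) t := by
      rw [← h3]
      exact h1.hasFDerivAt
    simpa [hskew] using h2.hasDerivAt
  simpa using is_const_of_deriv_eq_zero (fun t => (hd t).differentiableAt)
    (fun t => (hd t).deriv) t 0

namespace IsTriHamiltonian

variable {H : HyperkahlerStructure E M} {X : VField E M} {μ : M → EuclideanSpace ℝ (Fin 3)}

lemma invariant (hμ : IsTriHamiltonian H X μ) (z : Circle) (x : M) : μ (z • x) = μ x := by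
  ext i
  have hH := fun x => isHyperhermitian_at H x
  have hg : ∀ (x : M) (u v : E), metricAt H.g x u v = metricAt H.g x v u := H.g.symm
  fin_cases i
  · exact moment_invariant hμ.generates (contMDiff_coord hμ.smooth 0) hμ.moment_I
      (fun x v => by have := (hH x).skewI v v; rw [hg x v] at this; linarith) z x
  · exact moment_invariant hμ.generates (contMDiff_coord hμ.smooth 1) hμ.moment_J
      (fun x v => by have := (hH x).skewJ v v; rw [hg x v] at this; linarith) z x
  · exact moment_invariant hμ.generates (contMDiff_coord hμ.smooth 2) hμ.moment_K
      (fun x v => by have := (hH x).skewK v v; rw [hg x v] at this; linarith) z x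

/-- The moment map is open at points that are not fixed: it is a submersion there. -/
lemma nhds_le_map_of_ne_zero [FiniteDimensional ℝ E] (hμ : IsTriHamiltonian H X μ) {x : M}
    (hx : X.at x ≠ 0) : 𝓝 (μ x) ≤ Filter.map μ (𝓝 x) := by
  set χ := chartAt E x with hχ
  have hxs : x ∈ χ.source := mem_chart_source E x
  have hxt : χ x ∈ χ.target := χ.map_source hxs
  have hinv : χ.symm (χ x) = x := χ.left_inv hxs
  have hmd : χ.MDifferentiable 𝓘(ℝ, E) 𝓘(ℝ, E) := mdifferentiable_chart x
  have hsm : ContMDiffAt 𝓘(ℝ, E) 𝓘(ℝ, E) ∞ χ.symm (χ x) :=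
    (contMDiffOn_chart_symm (I := 𝓘(ℝ, E)) (n := ∞) (x := x)).contMDiffAt
      (χ.open_target.mem_nhds hxt)
  have hder : HasMFDerivAt 𝓘(ℝ, E) 𝓘(ℝ, E) χ.symm (χ x) (paramDeriv χ.symm (χ x) : E →L[ℝ] E) :=
    (hmd.mdifferentiableAt_symm hxt).hasMFDerivAt
  have hsurj : Function.Surjective (paramDeriv χ.symm (χ x) : E →L[ℝ] E) :=
    hmd.symm.mfderiv_surjective hxt
  have hcd : ContDiffAt ℝ ∞ (μ ∘ χ.symm) (χ x) :=
    (ContMDiffAt.comp (χ x) (hμ.smooth (χ.symm (χ x))) hsm).contDiffAt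
  have hstrict := hcd.hasStrictFDerivAt (by simp)
  have hI := moment_coord (contMDiff_coord hμ.smooth 0) hμ.moment_I hder
  have hJ := moment_coord (contMDiff_coord hμ.smooth 1) hμ.moment_J hder
  have hK := moment_coord (contMDiff_coord hμ.smooth 2) hμ.moment_K hder
  have hcoord : ∀ (i : Fin 3) (v : E), fderiv ℝ (μ ∘ χ.symm) (χ x) v i =
      fderiv ℝ (fun u => μ (χ.symm u) i) (χ x) v := by
    intro i v
    have h1 := (EuclideanSpace.proj i : EuclideanSpace ℝ (Fin 3) →L[ℝ] ℝ).hasFDerivAt.comp (χ x)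
      hstrict.hasFDerivAt
    have h2 : fderiv ℝ (fun u => μ (χ.symm u) i) (χ x) = _ := h1.fderiv
    rw [h2]
    rfl
  have hrange : (fderiv ℝ (μ ∘ χ.symm) (χ x)).range = ⊤ := by
    rw [LinearMap.range_eq_top]
    intro y
    obtain ⟨v, h0, h1, h2⟩ := (isHyperhermitian_at H x).exists_moment_preimage hx y
    obtain ⟨u, rfl⟩ := hsurj v
    refine ⟨u, ?_⟩
    ext i
    change fderiv ℝ (μ ∘ χ.symm) (χ x) u i = y i
    rw [hcoord]
    fin_cases i
    · refine Eq.trans (congrArg (fun L : E →L[ℝ] ℝ => L u) hI.fderiv) ?_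
      rw [hinv]
      exact h0
    · refine Eq.trans (congrArg (fun L : E →L[ℝ] ℝ => L u) hJ.fderiv) ?_
      rw [hinv]
      exact h1
    · refine Eq.trans (congrArg (fun L : E →L[ℝ] ℝ => L u) hK.fderiv) ?_
      rw [hinv]
      exact h2
  have hmap := hstrict.map_nhds_eq_of_surj hrange
  have hnhds := χ.symm.map_nhds_eq (x := χ x) hxt
  rw [← Filter.map_map, hnhds, Function.comp_apply, hinv] at hmap
  exact hmap.ge

end IsTriHamiltonian

end

/-! ### Homeomorphisms from orbit spaces -/

/-- Reduces the claim to the parameter space: since φ maps Ω onto S, openness of μ on S and the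
identification of its fibres with orbits need only be checked for μ ∘ φ. -/
lemma inducesHomeomorph_of_image {P M N : Type*} [TopologicalSpace P] [TopologicalSpace M]
    [TopologicalSpace N] [MulAction Circle M] {φ : P → M} {Ω : Set P} (hΩ : IsOpen Ω)
    (hφ : ContinuousOn φ Ω) {S : SubMulAction Circle M} (hS : φ '' Ω = (S : Set M)) {μ : M → N}
    (hμ : Continuous μ) (hinv : ∀ (z : Circle) x, μ (z • x) = μ x) {B : Set N}
    (himage : μ '' (φ '' Ω) = B)
    (hopen : ∀ V ⊆ Ω, IsOpen V → IsOpen ((fun q => μ (φ q)) '' V))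
    (hfib : ∀ q ∈ Ω, ∀ q' ∈ Ω, μ (φ q) = μ (φ q') → ∃ z : Circle, φ q = z • φ q') :
    InducesHomeomorph S μ B := by
  have hSB : ∀ x : S, μ x ∈ B := fun x => by
    rw [← himage, hS]; exact Set.mem_image_of_mem μ x.2
  let F : S → B := fun x => ⟨μ x, hSB x⟩
  have hF : Continuous F := by fun_prop
  have hFo : IsOpenMap F := by
    rintro _ ⟨O, hO, rfl⟩
    have h1 : IsOpen (Ω ∩ φ ⁻¹' O) := hφ.isOpen_inter_preimage hΩ hO
    have h2 := hopen _ Set.inter_subset_left h1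
    have h3 : F '' (Subtype.val ⁻¹' O) =
        Subtype.val ⁻¹' ((fun q => μ (φ q)) '' (Ω ∩ φ ⁻¹' O)) := by
      ext y
      constructor
      · rintro ⟨x, hx, rfl⟩
        obtain ⟨q, hq, hqx⟩ : (x : M) ∈ φ '' Ω := by rw [hS]; exact x.2
        refine ⟨q, ⟨hq, ?_⟩, ?_⟩
        · rw [Set.mem_preimage, hqx]; exact hx
        · simp only [hqx]; rfl
      · rintro ⟨q, ⟨hq, hqO⟩, hqy⟩
        have hqS : φ q ∈ S := by
          rw [← SetLike.mem_coe, ← hS]; exact Set.mem_image_of_mem φ hq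
        exact ⟨⟨φ q, hqS⟩, hqO, Subtype.ext hqy⟩
    rw [h3]
    exact h2.preimage continuous_subtype_val
  have hFs : Function.Surjective F := by
    rintro ⟨y, hy⟩
    rw [← himage, hS] at hy
    obtain ⟨x, hx, rfl⟩ := hy
    exact ⟨⟨x, hx⟩, rfl⟩
  have hrel : ∀ x y : S, (MulAction.orbitRel Circle S) x y → F x = F y := by
    rintro x y ⟨z, rfl⟩
    exact Subtype.ext (hinv z y)
  let G : MulAction.orbitRel.Quotient Circle S → B := Quotient.lift F hrel
  have hG : Continuous G := hF.quotient_lift hrel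
  have hGo : IsOpenMap G := by
    intro O hO
    have h1 : G '' O = F '' (Quotient.mk (MulAction.orbitRel Circle S) ⁻¹' O) := by
      ext y
      constructor
      · rintro ⟨x, hx, rfl⟩
        obtain ⟨x, rfl⟩ := Quotient.exists_rep x
        exact ⟨x, hx, rfl⟩
      · rintro ⟨x, hx, rfl⟩
        exact ⟨_, hx, rfl⟩
    rw [h1]
    exact hFo _ (hO.preimage continuous_quotient_mk')
  have hGb : Function.Bijective G := by
    refine ⟨?_, fun y => (hFs y).imp' (Quotient.mk _) fun _ h => h⟩
    intro a b
    obtain ⟨x, rfl⟩ := Quotient.exists_rep a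
    obtain ⟨y, rfl⟩ := Quotient.exists_rep b
    intro hxy
    have hxy' : μ x = μ y := congrArg Subtype.val hxy
    obtain ⟨q, hq, hqx⟩ : (x : M) ∈ φ '' Ω := by rw [hS]; exact x.2
    obtain ⟨q', hq', hqy⟩ : (y : M) ∈ φ '' Ω := by rw [hS]; exact y.2
    obtain ⟨z, hz⟩ := hfib q hq q' hq' (by rw [hqx, hqy, hxy'])
    refine Quotient.sound ⟨z, Subtype.ext ?_⟩
    change z • (y : M) = x
    rw [← hqx, ← hqy, hz]
  exact ⟨(Equiv.ofBijective G hGb).toHomeomorphOfContinuousOpen hG hGo, fun x => rfl⟩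

/-! ### Quaternionic slices and openness of the moment map -/

section

variable {E : Type*} [NormedAddCommGroup E] [NormedSpace ℝ E] [FiniteDimensional ℝ E]
  {M : Type*} [TopologicalSpace M] [ChartedSpace E M] [IsManifold 𝓘(ℝ, E) ∞ M]
  [MulAction Circle M] [ContMDiffSMul (𝓡 1) 𝓘(ℝ, E) ∞ Circle M]

namespace IsLinearization

variable {p : M} {e : OpenPartialHomeomorph E M} {ρ : ℝ → E →L[ℝ] E}

/-- A linear quaternionic slice in a linearizing parametrization. -/
lemma isSlice (h : IsLinearization p e ρ) {H : HyperkahlerStructure E M} {k : ℤ} (hk : k ≠ 0)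
    {l : ℍ →L[ℝ] E} (hl : Function.Injective l)
    (hρ : ∀ t q, ρ t (l q) = l (rotate k (Circle.exp t) q))
    (hI : ∀ q, l (q * -qi) = conjEnd h.derivZero (H.I.at (e 0)) (l q))
    (hJ : ∀ q, l (q * -qj) = conjEnd h.derivZero (H.J.at (e 0)) (l q))
    (hK : ∀ q, l (q * -qk) = conjEnd h.derivZero (H.K.at (e 0)) (l q))
    {Ω : Set ℍ} (hΩ : IsOpen Ω) (h0 : 0 ∈ Ω) (hinv : ∀ z : Circle, ∀ q ∈ Ω, rotate k z q ∈ Ω)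
    (hsrc : ∀ q ∈ Ω, l q ∈ e.source) {S : SubMulAction Circle M}
    (hS : (fun q => e (l q)) '' Ω = (S : Set M)) : IsSlice H p S := by
  have hder : ∀ q ∈ Ω, HasMFDerivAt 𝓘(ℝ, ℍ) 𝓘(ℝ, E) (fun q => e (l q)) q
      ((paramDeriv e (l q) : E →L[ℝ] E).comp l) := fun q hq =>
    HasMFDerivAt.comp q (h.hasMFDerivAt (hsrc q hq)) l.hasMFDerivAt
  have hder0 : ∀ v : ℍ, (paramDeriv (fun q => e (l q)) 0 : ℍ →L[ℝ] E) v =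
      h.derivZero (l v) := by
    intro v
    have h1 : (paramDeriv (fun q => e (l q)) 0 : ℍ →L[ℝ] E) =
      (paramDeriv e (l 0) : E →L[ℝ] E).comp l := (hder 0 h0).mfderiv
    rw [h1, _root_.map_zero]
    rfl
  have hcomm : ∀ (A : EndField E M) (a : ℍ),
      (∀ q, l (q * a) = conjEnd h.derivZero (A.at (e 0)) (l q)) → ∀ v : ℍ,
      (paramDeriv (fun q => e (l q)) 0 : ℍ →L[ℝ] E) (v * a) =
        A.at (e (l 0)) ((paramDeriv (fun q => e (l q)) 0 : ℍ →L[ℝ] E) v) := by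
    intro A a hA v
    rw [hder0, hder0, hA, apply_conjEnd, _root_.map_zero]
  refine ⟨k, Ω, fun q => e (l q), hk, hΩ, h0, hinv, ?_, ?_, ?_, hS, ?_, ?_, fun v =>
    ⟨hcomm H.I _ hI v, hcomm H.J _ hJ v, hcomm H.K _ hK v⟩⟩
  · exact h.smooth.comp l.contMDiff.contMDiffOn hsrc
  · intro q hq
    rw [(hder q hq).mfderiv]
    exact (h.paramDeriv_injective (hsrc q hq)).comp hl
  · have h1 : Topology.IsEmbedding (fun q : Ω => l q) :=
      (LinearMap.isClosedEmbedding_of_injective (f := (l : ℍ →ₗ[ℝ] E))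
        (LinearMap.ker_eq_bot.2 hl)).isEmbedding.comp Topology.IsEmbedding.subtypeVal
    exact e.isOpenEmbedding_restrict.isEmbedding.comp
      (h1.codRestrict e.source fun q => hsrc q q.2)
  · change e (l 0) = p
    rw [_root_.map_zero, h.map_zero]
  · intro z q hq
    obtain ⟨t, rfl⟩ := Circle.exp_surjective z
    change e (l _) = _
    rw [← hρ, h.equivariant _ (hsrc q hq)]

end IsLinearization

/-- At every fixed point there are arbitrarily small quaternionic slices whose orbit space is
mapped homeomorphically onto a ball by the moment map. -/
lemma IsTriHamiltonian.exists_slice [T2Space M] [ConnectedSpace M] [FaithfulSMul Circle M]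
    {H : HyperkahlerStructure E M} {X : VField E M} {μ : M → EuclideanSpace ℝ (Fin 3)}
    (hμ : IsTriHamiltonian H X μ) {p : M} (hp : ∀ z : Circle, z • p = p) {U : Set M}
    (hU : U ∈ 𝓝 p) :
    ∃ (S : SubMulAction Circle M) (r : ℝ), 0 < r ∧ (S : Set M) ⊆ U ∧ IsSlice H p S ∧
      InducesHomeomorph S μ (Metric.ball (μ p) r) := by
  obtain ⟨e, ρ, h⟩ := exists_isLinearization (E := E) hp
  have hH := (isHyperhermitian_at H (e 0)).pullback h.derivZero
  have hρ := h.isCircleRep hμ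
  obtain ⟨k, w, hk, hw0, hw⟩ := hρ.exists_weight_vector hH h.exists_ne_id
  have hf := h.isHopfLike hμ hw
  have hmap := hρ.map_quaternionLine hH hw
  have hinj := quaternionLine_injective hH hw0
  have hqi := quaternionLine_mul_neg_qi hH w
  have hqj := quaternionLine_mul_neg_qj hH w
  have hqk := quaternionLine_mul_neg_qk hH w
  set l := quaternionLine (conjEnd h.derivZero (H.I.at (e 0)))
    (conjEnd h.derivZero (H.J.at (e 0))) (conjEnd h.derivZero (H.K.at (e 0))) w with hl
  have hl0 : e (l 0) = p := by rw [map_zero, h.map_zero]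
  have hc : (k : ℝ) * pullForm h.derivZero (metricAt H.g (e 0)) w w / 2 ≠ 0 := by
    have h1 := (hH.pos w hw0).ne'
    have h2 : (k : ℝ) ≠ 0 := by exact_mod_cast hk
    positivity
  have hnear : l ⁻¹' (e.source ∩ e ⁻¹' U) ∈ 𝓝 (0 : ℍ) := by
    refine l.continuous.continuousAt.preimage_mem_nhds ?_
    rw [map_zero]
    refine Filter.inter_mem (e.open_source.mem_nhds h.zero_mem)
      ((e.continuousAt h.zero_mem).preimage_mem_nhds ?_)
    rwa [h.map_zero]
  obtain ⟨ε, hε, hball⟩ := Metric.mem_nhds_iff.1 hnear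
  have hequiv : ∀ q ∈ Metric.ball (0 : ℍ) ε, ∀ z : Circle, e (l (rotate k z q)) = z • e (l q) := by
    intro q hq z
    obtain ⟨t, rfl⟩ := Circle.exp_surjective z
    rw [← hmap, h.equivariant _ (hball hq).1]
  -- `local_structure` speaks of weight one rotations, while the slice has weight k; the orbits
  -- agree because k-th roots exist in the circle.
  have hroot : ∀ (z : Circle) (q : ℍ), ∃ y : Circle, rotate 1 z q = rotate k y q := by
    intro z q
    obtain ⟨y, rfl⟩ := exists_zpow_eq hk z
    exact ⟨y, (rotate_eq_rotate_one k y q).symm⟩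
  obtain ⟨δ, hδ, hδε, hcont, hfib, hopen⟩ := hf.local_structure hc hε (by
    intro q hq z
    obtain ⟨y, hy⟩ := hroot z q
    simp only [hy, hequiv q hq, hμ.invariant])
  set f := fun q : ℍ => μ (e (l q)) with hfdef
  have hfp : f 0 = μ p := congrArg μ hl0
  have himg : f '' Metric.ball 0 δ ∈ 𝓝 (μ p) := (hopen _ subset_rfl Metric.isOpen_ball).mem_nhds
    ⟨0, Metric.mem_ball_self hδ, hfp⟩
  obtain ⟨r, hr, hrball⟩ := Metric.mem_nhds_iff.1 himg
  -- Intersecting with the preimage of a ball contained in the image makes the image of the slice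
  -- exactly that ball. Invariance of μ keeps Ω invariant.
  set Ω := Metric.ball (0 : ℍ) δ ∩ f ⁻¹' Metric.ball (μ p) r with hΩ
  have hΩo : IsOpen Ω := hcont.isOpen_inter_preimage Metric.isOpen_ball Metric.isOpen_ball
  have hΩδ : Ω ⊆ Metric.ball 0 δ := Set.inter_subset_left
  have hΩε : Ω ⊆ Metric.ball 0 ε := hΩδ.trans (Metric.ball_subset_ball hδε)
  have h0Ω : (0 : ℍ) ∈ Ω :=
    ⟨Metric.mem_ball_self hδ, by rw [Set.mem_preimage, hfp]; exact Metric.mem_ball_self hr⟩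
  have hrot : ∀ z : Circle, ∀ q ∈ Ω, rotate k z q ∈ Ω := by
    intro z q hq
    refine ⟨?_, ?_⟩
    · rw [mem_ball_zero_iff, norm_rotate]; exact mem_ball_zero_iff.1 hq.1
    · have h1 : f (rotate k z q) = f q := by
        simp only [hfdef, hequiv q (hΩε hq), hμ.invariant]
      rw [Set.mem_preimage, h1]
      exact hq.2
  let S : SubMulAction Circle M :=
    { carrier := (fun q => e (l q)) '' Ω
      smul_mem' := by
        rintro z _ ⟨q, hq, rfl⟩
        exact ⟨_, hrot z q hq, hequiv q (hΩε hq) z⟩ }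
  refine ⟨S, r, hr, ?_, h.isSlice hk hinj hmap hqi hqj hqk hΩo h0Ω hrot
    (fun q hq => (hball (hΩε hq)).1) rfl, ?_⟩
  · rintro _ ⟨q, hq, rfl⟩
    exact (hball (hΩε hq)).2
  · refine inducesHomeomorph_of_image hΩo
      (e.continuousOn.comp l.continuous.continuousOn fun q hq => (hball (hΩε hq)).1) rfl
      hμ.smooth.continuous hμ.invariant ?_
      (fun V hV => hopen V (hV.trans hΩδ)) ?_
    · rw [Set.image_image]
      refine Set.Subset.antisymm ?_ fun y hy => ?_
      · rintro _ ⟨q, hq, rfl⟩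
        exact hq.2
      · obtain ⟨q, hq, rfl⟩ := hrball hy
        exact ⟨q, ⟨hq, hy⟩, rfl⟩
    · intro q hq q' hq' hqq'
      obtain ⟨z, rfl⟩ := hfib q (hΩδ hq) q' (hΩδ hq') hqq'
      obtain ⟨y, hy⟩ := hroot z q'
      exact ⟨y, by rw [hy]; exact hequiv q' (hΩε hq') y⟩

lemma IsTriHamiltonian.isOpenMap [T2Space M] [ConnectedSpace M] [FaithfulSMul Circle M]
    {H : HyperkahlerStructure E M} {X : VField E M} {μ : M → EuclideanSpace ℝ (Fin 3)}
    (hμ : IsTriHamiltonian H X μ) : IsOpenMap μ := by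
  refine isOpenMap_iff_nhds_le.2 fun x => ?_
  by_cases hx : X.at x = 0
  -- At a zero of X, a slice inside V already maps onto a ball around μ x.
  · intro V hV
    obtain ⟨S, r, hr, hSV, -, Φ, hΦ⟩ :=
      hμ.exists_slice (fixed_of_generator_eq_zero hμ.generates hx) hV
    refine Filter.mem_of_superset (Metric.ball_mem_nhds _ hr) fun y hy => ?_
    obtain ⟨a, ha⟩ := Φ.surjective ⟨y, hy⟩
    obtain ⟨s, rfl⟩ := Quotient.exists_rep a
    have h1 := hΦ s
    rw [ha] at h1
    have h2 : y = μ s := h1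
    rw [h2]
    exact hSV s.2
  · exact hμ.nhds_le_map_of_ne_zero hx

end

end Hyperkahler

end

theorem proposition7p1
    {E : Type*} [NormedAddCommGroup E] [NormedSpace ℝ E] [FiniteDimensional ℝ E]
    {M : Type*} [TopologicalSpace M] [ChartedSpace E M] [IsManifold 𝓘(ℝ, E) ∞ M]
    [T2Space M] [SecondCountableTopology M] [ConnectedSpace M]
    [MulAction Circle M] [ContMDiffSMul (𝓡 1) 𝓘(ℝ, E) ∞ Circle M] [FaithfulSMul Circle M]
    (h : Hyperkahler.HyperkahlerStructure E M) (X : Hyperkahler.VField E M)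
    (μ : M → EuclideanSpace ℝ (Fin 3)) (hμ : Hyperkahler.IsTriHamiltonian h X μ) :
    IsOpenMap μ ∧
    ∀ p : M, (∀ z : Circle, z • p = p) → ∀ U ∈ 𝓝 p,
      ∃ (S : SubMulAction Circle M) (r : ℝ), 0 < r ∧ (S : Set M) ⊆ U ∧
        Hyperkahler.IsSlice h p S ∧
        Hyperkahler.InducesHomeomorph S μ (Metric.ball (μ p) r) := by
  exact ⟨hμ.isOpenMap, fun p hp U hU => hμ.exists_slice hp hU⟩
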